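/- **Rectangles.** A rectangle $R$ is given by two opposite corners $(x_1,y_1),(x_2,y_2)\in\mathbb N^2$ with $x_1<x_2$, $y_1<y_2$, and a positive weight $w(R)$; it is regarded as the open set $(x_1,x_2)\times(y_1,y_2)$. Two rectangles are non-overlapping if these sets are disjoint. An instance of Maximum Weight Independent Set of Rectangles consists of $n$ rectangles, and one looks for a set of pairwise non-overlapping rectangles of maximum total weight. **Polygons.** A polygonal region with at most $m$ edges is a compact set $P\subseteq\mathbb R^2$ that is the closure of its interior and whose topological boundary is a union of at most $m$ axis-parallel segments (so holes, whose edges are counted, and non-simple boundaries are allowed; the corners are the end points of the segments). A connected polygonal region is called a polygon. **Cuts.** Let $0<\alpha<1$ and $\ell\in\mathbb N$. A balanced $\alpha$-cheap $\ell$-cut for a finite set $\bar{\mathcal R}$ of pairwise non-overlapping rectangles is a polygonal region $P$ with at most $\ell$ edges (not necessarily connected, and with arbitrary real corners) such that the rectangles of $\bar{\mathcal R}$ that meet the boundary of $P$ have total weight at most $\alpha\, w(\bar{\mathcal R})$, those contained in $P$ have total weight at most $\frac23 w(\bar{\mathcal R})$, and those contained in $\mathbb R^2\setminus P$ have total weight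 at most $\frac23 w(\bar{\mathcal R})$. **GEO-DP with parameter $k\in\mathbb N$.** If not all coordinates of the $n$ input rectangles lie in $\{0,\dots,2n-1\}$, every $x$-coordinate is first replaced by its rank among all occurring $x$-coordinates (counted from $0$), and likewise for the $y$-coordinates. The cells of the dynamic programming table are the polygons $P\subseteq[0,2n-1]^2$ with at most $k$ axis-parallel edges all of whose corners are integral. Let $\mathcal R_P$ be the set of input rectangles contained in $P$. If $\mathcal R_P=\emptyset$, then $sol(P)=\emptyset$. Otherwise consider all partitions of $P$ into at most $k$ cells $P_1,\dots,P_{k'}$ (their interiors are pairwise disjoint, their union is $P$, and none of them is $P$ itself); let $sol'(P)=\bigcup_i sol(P_i)$ for a partition that maximizes $\sum_i w(sol(P_i))$. If such a partition exists and $w(sol'(P))>\max_{R\in\mathcal R_P}w(R)$, then $sol(P)=sol'(P)$; otherwise $sol(P)=\{R_{\max}\}$ for some $R_{\max}\in\mathcal R_P$ of maximum weight. Ties are broken arbitrarily. The output is $sol([0,2n-1]^2)$. **Lemma.** There are absolute constants $C_1,C_2>0$ such that the following holds. Let $\varepsilon>0$, $0<\alpha<\frac12$, and let $\ell\ge 4$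 be an integer, such that every finite set $\bar{\mathcal R}$ of pairwise non-overlapping rectangles (with arbitrary positive weights) has a balanced $\alpha$-cheap $\ell$-cut or contains a rectangle $R$ with $w(R)\ge\frac13 w(\bar{\mathcal R})$. Let $n$ satisfy $n/\varepsilon\ge 2$ and $n\ge\varepsilon^2$ (for $\varepsilon\le1$ the second condition holds for all $n\ge1$), and let $k$ be any integer with $$k\ \ge\ C_1\,\ell^2\log^2(n/\varepsilon).$$ Then on every instance of $n$ rectangles with weights in $[1,n/\varepsilon]$, GEO-DP with parameter $k$ is well defined (a table as described exists), and for every way of breaking ties its output is a set of pairwise non-overlapping rectangles whose weight is at least $$(1+\alpha)^{-C_2\log(n/\varepsilon)}\cdot OPT ,$$ where $OPT$ is the maximum weight of a set of pairwise non-overlapping rectangles of the instance. In particular, GEO-DP has approximation ratio $(1+\alpha)^{O(\log(n/\varepsilon))}$ for some $k=\ell^2\cdot O(\log^2(n/\varepsilon))$. -/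

import Mathlib

noncomputable section

namespace GeoDP

/-- An axis-parallel rectangle, given by two opposite corners `(x₁, y₁)`, `(x₂, y₂)` in `ℕ²`. -/
structure Rect where
  x₁ : ℕ
  y₁ : ℕ
  x₂ : ℕ
  y₂ : ℕ
  hx : x₁ < x₂
  hy : y₁ < y₂

/-- The area of a rectangle is an open subset of the plane. -/
def Rect.area (R : Rect) : Set (ℝ × ℝ) :=
  Set.Ioo (R.x₁ : ℝ) (R.x₂ : ℝ) ×ˢ Set.Ioo (R.y₁ : ℝ) (R.y₂ : ℝ)

/-- Total weight of the rectangles with indices in `S`. -/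
def weight {n : ℕ} (w : Fin n → ℝ) (S : Finset (Fin n)) : ℝ := ∑ i ∈ S, w i

/-- The rectangles with indices in `S` are pairwise non-overlapping. -/
def IsIndependent {n : ℕ} (R : Fin n → Rect) (S : Finset (Fin n)) : Prop :=
  ∀ i ∈ S, ∀ j ∈ S, i ≠ j → Disjoint (R i).area (R j).area

/-! ### Axis-parallel polygonal regions -/

/-- `P` is a bounded closed region (without lower-dimensional parts) whose boundary is the union
of the axis-parallel edges in `E`; an edge is given by its two end points. Edges bounding holes
are in `E` as well, and edges may cross or touch, so holes and non-simple regions are allowed.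
For the least possible `E`, its members are the maximal boundary segments of `P`, and their end
points are the corners of `P`. -/
structure IsRegion (P : Set (ℝ × ℝ)) (E : Finset ((ℝ × ℝ) × (ℝ × ℝ))) : Prop where
  isCompact : IsCompact P
  regular : closure (interior P) = P
  axisParallel : ∀ e ∈ E, e.1.1 = e.2.1 ∨ e.1.2 = e.2.2
  frontier_eq : frontier P = ⋃ e ∈ E, segment ℝ e.1 e.2

/-! ### Balanced cheap cuts -/

open Classical in
/-- `P` is a balanced `α`-cheap `ℓ`-cut for the rectangles `R i` with weights `w i`. -/
structure IsBalancedCut {m : ℕ} (R : Fin m → Rect) (w : Fin m → ℝ) (α : ℝ) (ℓ : ℕ)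
    (P : Set (ℝ × ℝ)) : Prop where
  edges : ∃ E, E.card ≤ ℓ ∧ IsRegion P E
  cheap : weight w {i | ((R i).area ∩ frontier P).Nonempty} ≤ α * weight w Finset.univ
  inside : weight w {i | (R i).area ⊆ P} ≤ 2 / 3 * weight w Finset.univ
  outside : weight w {i | (R i).area ⊆ Pᶜ} ≤ 2 / 3 * weight w Finset.univ

/-- Every finite set of pairwise non-overlapping rectangles with positive weights has a balanced
`α`-cheap `ℓ`-cut or contains a rectangle of at least one third of the total weight. -/
def GoodCuts (α : ℝ) (ℓ : ℕ) : Prop :=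
  ∀ (m : ℕ) (R : Fin m → Rect) (w : Fin m → ℝ), (∀ i, 0 < w i) →
    IsIndependent R Finset.univ →
      (∃ P, IsBalancedCut R w α ℓ P) ∨ ∃ i, 1 / 3 * weight w Finset.univ ≤ w i

/-! ### The preprocessing of the coordinates -/

/-- The position of `v` in the ordered list of the members of `S`, counted from `0`. -/
def rank (S : Finset ℕ) (v : ℕ) : ℕ := {s ∈ S | s < v}.card

theorem rank_lt_rank {S : Finset ℕ} {u v : ℕ} (hu : u ∈ S) (h : u < v) :
    rank S u < rank S v := by
  apply Finset.card_lt_card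
  rw [Finset.ssubset_iff_of_subset (fun s hs => by
    simp only [Finset.mem_filter] at hs ⊢
    exact ⟨hs.1, hs.2.trans h⟩)]
  exact ⟨u, by simp [hu, h], by simp⟩

/-- All `x`-coordinates of corners. -/
def xCoords {n : ℕ} (R : Fin n → Rect) : Finset ℕ :=
  Finset.univ.image (fun i => (R i).x₁) ∪ Finset.univ.image (fun i => (R i).x₂)

/-- All `y`-coordinates of corners. -/
def yCoords {n : ℕ} (R : Fin n → Rect) : Finset ℕ :=
  Finset.univ.image (fun i => (R i).y₁) ∪ Finset.univ.image (fun i => (R i).y₂)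

/-- Replace every coordinate by its rank; the order of the coordinates does not change. -/
def compress {n : ℕ} (R : Fin n → Rect) (i : Fin n) : Rect where
  x₁ := rank (xCoords R) (R i).x₁
  y₁ := rank (yCoords R) (R i).y₁
  x₂ := rank (xCoords R) (R i).x₂
  y₂ := rank (yCoords R) (R i).y₂
  hx := rank_lt_rank (by simp [xCoords]) (R i).hx
  hy := rank_lt_rank (by simp [yCoords]) (R i).hy

open Classical in
/-- If all coordinates are in `{0, …, 2n-1}` the instance is kept, and otherwise it is replaced
by an equivalent one with this property. -/
def normalize {n : ℕ} (R : Fin n → Rect) : Fin n → Rect :=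
  if ∀ i, (R i).x₂ < 2 * n ∧ (R i).y₂ < 2 * n then R else compress R

/-! ### The dynamic program -/

/-- The input square `[0, 2n-1] × [0, 2n-1]`. -/
def inputSquare (n : ℕ) : Set (ℝ × ℝ) :=
  Set.Icc (0 : ℝ) (2 * (n : ℝ) - 1) ×ˢ Set.Icc (0 : ℝ) (2 * (n : ℝ) - 1)

/-- A point of the plane with integer coordinates. -/
def IsIntegral (p : ℝ × ℝ) : Prop := ∃ a b : ℤ, p = ((a : ℝ), (b : ℝ))

/-- The cells of the table: the polygons in the input square with at most `k` axis-parallel edges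
and with integral corners. -/
structure IsCell (n k : ℕ) (P : Set (ℝ × ℝ)) : Prop where
  subset : P ⊆ inputSquare n
  connected : IsConnected P
  edges : ∃ E : Finset ((ℝ × ℝ) × (ℝ × ℝ)), E.card ≤ k ∧ IsRegion P E ∧
    ∀ e ∈ E, IsIntegral e.1 ∧ IsIntegral e.2

/-- `Q` is a partition of `P` into at most `k` cells. The trivial partition `{P}`, which would
make the computation of the entry for `P` refer to itself, is not among those enumerated. -/
structure IsPartition (n k : ℕ) (P : Set (ℝ × ℝ)) (Q : Finset (Set (ℝ × ℝ))) : Prop where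
  card_le : Q.card ≤ k
  cells : ∀ A ∈ Q, IsCell n k A
  disjoint : ∀ A ∈ Q, ∀ B ∈ Q, A ≠ B → Disjoint (interior A) (interior B)
  union_eq : ⋃ A ∈ Q, A = P
  proper : P ∉ Q

open Classical in
/-- The rectangles contained in `P`. -/
def rectsIn {n : ℕ} (R : Fin n → Rect) (P : Set (ℝ × ℝ)) : Finset (Fin n) :=
  {i | (R i).area ⊆ P}

/-- The profit of a partition with respect to the table `sol`. -/
def profit {n : ℕ} (w : Fin n → ℝ) (sol : Set (ℝ × ℝ) → Finset (Fin n))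
    (Q : Finset (Set (ℝ × ℝ))) : ℝ := ∑ A ∈ Q, weight w (sol A)

open Classical in
/-- `sol` is a table which the dynamic program with parameter `k` computes. An entry is empty if
no rectangle is contained in the cell. Otherwise it is the union of the entries of a partition of
maximum profit, if this is more than the weight of each single rectangle in the cell, and else it
consists of a rectangle of maximum weight in the cell. Ties are broken arbitrarily. -/
def IsTable {n : ℕ} (k : ℕ) (R : Fin n → Rect) (w : Fin n → ℝ)
    (sol : Set (ℝ × ℝ) → Finset (Fin n)) : Prop :=
  ∀ P, IsCell n k P →
    (rectsIn R P = ∅ ∧ sol P = ∅) ∨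
    ((rectsIn R P).Nonempty ∧ ∃ Q, IsPartition n k P Q ∧
      (∀ Q', IsPartition n k P Q' → profit w sol Q' ≤ profit w sol Q) ∧
      (∀ i ∈ rectsIn R P, w i < profit w sol Q) ∧ sol P = Q.biUnion sol) ∨
    (∃ i ∈ rectsIn R P, (∀ j ∈ rectsIn R P, w j ≤ w i) ∧
      (∀ Q, IsPartition n k P Q → profit w sol Q ≤ w i) ∧ sol P = {i})

/-- On the rectangles `R i` with weights `w i`, GEO-DP with parameter `k` computes a table, and
for every way of breaking ties its output, the entry for the input square, is a set of pairwise
non-overlapping rectangles whose weight is at least `1 / ρ` times that of every such set. -/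
def Approximates {n : ℕ} (k : ℕ) (R : Fin n → Rect) (w : Fin n → ℝ) (ρ : ℝ) : Prop :=
  (∃ sol, IsTable k (normalize R) w sol) ∧
  ∀ sol, IsTable k (normalize R) w sol →
    IsIndependent R (sol (inputSquare n)) ∧
    ∀ S, IsIndependent R S → weight w S ≤ ρ * weight w (sol (inputSquare n))

end GeoDP

end

/-! The analysis exhibits one recursive partition that the dynamic program may choose. Start with an
optimal independent set `S` in the input square and cut repeatedly, each time splitting the current
rectangles by a balanced cheap cut. If one rectangle carries a third of the weight, its own outline
serves as the cut and nothing is lost. Otherwise a cut loses at most an `α` fraction of the weight,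
and each side keeps at most two thirds. Since weights are at least 1, after `d` levels with `(3/2) ^
d` at least the total weight every part holds at most one rectangle. The entry of a cell is at least
the profit of any partition and at least the weight of any single rectangle in it
(`IsTable.profit_le`, `IsTable.le_weight`), so at least `(1 - α) ^ d * weight w S` survives
(`IsTable.lower_bound`).

The complexity of the parts is controlled by grid lines instead of edges. A part is a set of unit
squares that is a union of blocks of a grid with columns `X` and rows `Y` (`IsBlockSet`). A cut with
at most `ℓ` edges adds at most `ℓ` lines in each direction, so at depth `d` there are at most `M = 2
+ d * ℓ` of each. Such a part has at most `2 * M ^ 2` boundary edges (`IsBlockSet.exists_isRegion`),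
and each side of a cut has at most `M ^ 2` connected components (`IsBlockSet.exists_components`).
Hence `k ≥ 2 * M ^ 2` suffices.

Cuts may have real corners. Sampling the cut at the points `c + (δ, δ)`, with `δ` not the fractional
part of any of its line coordinates, turns it into a set of unit squares with no more lines and the
same rectangles on either side (`IsRegion.exists_sample`).

With `d` of order `log (n / ε)`, the bound `1 ≤ (1 + α) ^ 2 * (1 - α)` gives the stated ratio. -/

namespace GeoDP

/-! ### Unions of unit squares: topology and boundary. -/

/-- The closed unit square with lower left corner `c`. -/
def unitSquare (c : ℤ × ℤ) : Set (ℝ × ℝ) :=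
  Set.Icc (c.1 : ℝ) (c.1 + 1) ×ˢ Set.Icc (c.2 : ℝ) (c.2 + 1)

/-- The open unit square with lower left corner `c`. -/
def openUnitSquare (c : ℤ × ℤ) : Set (ℝ × ℝ) :=
  Set.Ioo (c.1 : ℝ) (c.1 + 1) ×ˢ Set.Ioo (c.2 : ℝ) (c.2 + 1)

/-- The union of the closed unit squares with lower left corners in `A`. -/
def gridUnion (A : Set (ℤ × ℤ)) : Set (ℝ × ℝ) := ⋃ c ∈ A, unitSquare c

theorem mem_unitSquare {c : ℤ × ℤ} {p : ℝ × ℝ} :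
    p ∈ unitSquare c ↔ (c.1 ≤ p.1 ∧ p.1 ≤ c.1 + 1) ∧ (c.2 ≤ p.2 ∧ p.2 ≤ c.2 + 1) := Iff.rfl

theorem mem_openUnitSquare {c : ℤ × ℤ} {p : ℝ × ℝ} :
    p ∈ openUnitSquare c ↔ (c.1 < p.1 ∧ p.1 < c.1 + 1) ∧ (c.2 < p.2 ∧ p.2 < c.2 + 1) := Iff.rfl

theorem mem_gridUnion {A : Set (ℤ × ℤ)} {p : ℝ × ℝ} :
    p ∈ gridUnion A ↔ ∃ c ∈ A, p ∈ unitSquare c := by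
  simp [gridUnion]

theorem unitSquare_subset_gridUnion {A : Set (ℤ × ℤ)} {c : ℤ × ℤ} (h : c ∈ A) :
    unitSquare c ⊆ gridUnion A := Set.subset_biUnion_of_mem h

theorem isOpen_openUnitSquare (c : ℤ × ℤ) : IsOpen (openUnitSquare c) :=
  isOpen_Ioo.prod isOpen_Ioo

theorem isPreconnected_openUnitSquare (c : ℤ × ℤ) : IsPreconnected (openUnitSquare c) :=
  isPreconnected_Ioo.prod isPreconnected_Ioo

theorem isPreconnected_unitSquare (c : ℤ × ℤ) : IsPreconnected (unitSquare c) :=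
  isPreconnected_Icc.prod isPreconnected_Icc

theorem isCompact_unitSquare (c : ℤ × ℤ) : IsCompact (unitSquare c) :=
  isCompact_Icc.prod isCompact_Icc

theorem closure_openUnitSquare (c : ℤ × ℤ) : closure (openUnitSquare c) = unitSquare c := by
  rw [openUnitSquare, closure_prod_eq, closure_Ioo (by simp), closure_Ioo (by simp), unitSquare]

theorem openUnitSquare_subset (c : ℤ × ℤ) : openUnitSquare c ⊆ unitSquare c :=
  closure_openUnitSquare c ▸ subset_closure

theorem eq_of_mem_openUnitSquare {c d : ℤ × ℤ} {p : ℝ × ℝ} (hc : p ∈ openUnitSquare c)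
    (hd : p ∈ unitSquare d) : c = d := by
  obtain ⟨⟨h1, h2⟩, h3, h4⟩ := mem_openUnitSquare.1 hc
  obtain ⟨⟨k1, k2⟩, k3, k4⟩ := mem_unitSquare.1 hd
  have a1 : (c.1 : ℝ) < d.1 + 1 := h1.trans_le k2
  have a2 : (d.1 : ℝ) < c.1 + 1 := k1.trans_lt h2
  have a3 : (c.2 : ℝ) < d.2 + 1 := h3.trans_le k4
  have a4 : (d.2 : ℝ) < c.2 + 1 := k3.trans_lt h4
  norm_cast at a1 a2 a3 a4
  ext <;> omega

/-- The centre of a unit square. -/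
noncomputable def center (c : ℤ × ℤ) : ℝ × ℝ := (c.1 + 1 / 2, c.2 + 1 / 2)

theorem center_mem (c : ℤ × ℤ) : center c ∈ openUnitSquare c := by
  simp only [mem_openUnitSquare, center]
  norm_num

theorem center_mem_unitSquare (c : ℤ × ℤ) : center c ∈ unitSquare c :=
  openUnitSquare_subset c (center_mem c)

theorem mem_of_mem_gridUnion {A : Set (ℤ × ℤ)} {c : ℤ × ℤ} {p : ℝ × ℝ}
    (hp : p ∈ openUnitSquare c) (h : p ∈ gridUnion A) : c ∈ A := by
  obtain ⟨d, hd, hpd⟩ := mem_gridUnion.1 h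
  exact eq_of_mem_openUnitSquare hp hpd ▸ hd

theorem center_mem_gridUnion {A : Set (ℤ × ℤ)} {c : ℤ × ℤ} :
    center c ∈ gridUnion A ↔ c ∈ A :=
  ⟨mem_of_mem_gridUnion (center_mem c), fun h =>
    unitSquare_subset_gridUnion h (center_mem_unitSquare c)⟩

theorem gridUnion_injective : Function.Injective gridUnion := fun A B h => by
  ext c
  rw [← center_mem_gridUnion, h, center_mem_gridUnion]

theorem mem_unitSquare_floor (p : ℝ × ℝ) : p ∈ unitSquare (⌊p.1⌋, ⌊p.2⌋) :=
  ⟨⟨Int.floor_le _, (Int.lt_floor_add_one _).le⟩, Int.floor_le _, (Int.lt_floor_add_one _).le⟩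

/-- Makes infinite unions of unit squares closed; this is needed for the complement of a finite set
of squares. -/
theorem locallyFinite_unitSquare : LocallyFinite unitSquare := by
  intro p
  refine ⟨Set.Ioo (p.1 - 1) (p.1 + 1) ×ˢ Set.Ioo (p.2 - 1) (p.2 + 1),
    (isOpen_Ioo.prod isOpen_Ioo).mem_nhds (by simp), ?_⟩
  refine ((Set.finite_Icc (⌊p.1⌋ - 2) (⌊p.1⌋ + 2)).prod
    (Set.finite_Icc (⌊p.2⌋ - 2) (⌊p.2⌋ + 2))).subset ?_
  rintro c ⟨q, ⟨⟨h1, h2⟩, h3, h4⟩, hq⟩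
  have key : ∀ (a : ℤ) (q u : ℝ), (a : ℝ) ≤ q → q ≤ a + 1 → u - 1 < q → q < u + 1 →
      a ∈ Set.Icc (⌊u⌋ - 2) (⌊u⌋ + 2) := by
    intro a q u h1 h2 h3 h4
    have f1 := Int.floor_le u
    have f2 := Int.lt_floor_add_one u
    have g1 : (a : ℝ) < ⌊u⌋ + 3 := by linarith
    have g2 : (⌊u⌋ : ℝ) < a + 3 := by linarith
    norm_cast at g1 g2
    constructor <;> omega
  obtain ⟨⟨k1, k2⟩, k3, k4⟩ := hq
  exact ⟨key _ _ _ h1 h2 k1 k2, key _ _ _ h3 h4 k3 k4⟩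

theorem isClosed_gridUnion (A : Set (ℤ × ℤ)) : IsClosed (gridUnion A) := by
  rw [gridUnion, Set.biUnion_eq_iUnion]
  exact (locallyFinite_unitSquare.comp_injective Subtype.val_injective).isClosed_iUnion
    fun c => (isCompact_unitSquare c).isClosed

theorem isCompact_gridUnion {A : Set (ℤ × ℤ)} (hA : A.Finite) : IsCompact (gridUnion A) :=
  hA.isCompact_biUnion fun c _ => isCompact_unitSquare c

theorem openUnitSquare_subset_interior {A : Set (ℤ × ℤ)} {c : ℤ × ℤ} (h : c ∈ A) :
    openUnitSquare c ⊆ interior (gridUnion A) :=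
  interior_maximal ((openUnitSquare_subset c).trans (unitSquare_subset_gridUnion h))
    (isOpen_openUnitSquare c)

theorem closure_interior_gridUnion (A : Set (ℤ × ℤ)) :
    closure (interior (gridUnion A)) = gridUnion A := by
  refine (closure_minimal interior_subset (isClosed_gridUnion A)).antisymm
    (Set.iUnion₂_subset fun c hc => ?_)
  rw [← closure_openUnitSquare]
  exact closure_mono (openUnitSquare_subset_interior hc)

theorem frontier_gridUnion (A : Set (ℤ × ℤ)) :
    frontier (gridUnion A) = gridUnion A ∩ gridUnion Aᶜ := by
  rw [frontier_eq_closure_inter_closure, (isClosed_gridUnion A).closure_eq]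
  congr 1
  apply (closure_minimal _ (isClosed_gridUnion _)).antisymm
  · refine Set.iUnion₂_subset fun c hc => ?_
    rw [← closure_openUnitSquare]
    exact closure_mono fun p hp h => hc (mem_of_mem_gridUnion hp h)
  · intro p hp
    refine mem_gridUnion.2 ⟨_, fun h => hp ?_, mem_unitSquare_floor p⟩
    exact unitSquare_subset_gridUnion h (mem_unitSquare_floor p)

theorem disjoint_interior_gridUnion {A B : Set (ℤ × ℤ)} (h : Disjoint A B) :
    Disjoint (interior (gridUnion A)) (interior (gridUnion B)) := by
  rw [Set.disjoint_left]
  intro p hA hB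
  obtain ⟨c, hc, hpc⟩ := mem_gridUnion.1 (interior_subset hA)
  rw [← closure_openUnitSquare] at hpc
  obtain ⟨q, hq, hqc⟩ := mem_closure_iff.1 hpc _ isOpen_interior hB
  exact Set.disjoint_left.1 h hc (mem_of_mem_gridUnion hqc (interior_subset hq))

/-! ### Sets of unit squares that are unions of blocks of a coarser grid -/

/-- `A` is constant along rows except at the columns in `X`, and along columns except at the rows
in `Y`. -/
structure Aligned (A : Set (ℤ × ℤ)) (X Y : Finset ℤ) : Prop where
  left : ∀ a b, a ∉ X → ((a - 1, b) ∈ A ↔ (a, b) ∈ A)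
  down : ∀ a b, b ∉ Y → ((a, b - 1) ∈ A ↔ (a, b) ∈ A)

namespace Aligned

variable {A B : Set (ℤ × ℤ)} {X X' Y Y' : Finset ℤ}

theorem mono (h : Aligned A X Y) (hX : X ⊆ X') (hY : Y ⊆ Y') : Aligned A X' Y' :=
  ⟨fun a b ha => h.left a b fun h => ha (hX h), fun a b hb => h.down a b fun h => hb (hY h)⟩

theorem inter (hA : Aligned A X Y) (hB : Aligned B X Y) : Aligned (A ∩ B) X Y :=
  ⟨fun a b ha => and_congr (hA.left a b ha) (hB.left a b ha),
    fun a b hb => and_congr (hA.down a b hb) (hB.down a b hb)⟩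

theorem compl (hA : Aligned A X Y) : Aligned Aᶜ X Y :=
  ⟨fun a b ha => not_congr (hA.left a b ha), fun a b hb => not_congr (hA.down a b hb)⟩

theorem swap (hA : Aligned A X Y) : Aligned (Prod.swap ⁻¹' A) Y X :=
  ⟨fun a b ha => hA.down b a ha, fun a b hb => hA.left b a hb⟩

theorem row_iff (hA : Aligned A X Y) {a a' : ℤ} (b : ℤ) (h : a ≤ a')
    (hX : ∀ x ∈ X, x ≤ a ∨ a' < x) : (a, b) ∈ A ↔ (a', b) ∈ A := by
  induction a', h using Int.leInduction with
  | base => rfl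
  | succ t ht ih =>
    rw [ih fun x hx => (hX x hx).imp_right fun h => by omega]
    have := hA.left (t + 1) b fun hx => by have := hX _ hx; omega
    simpa using this

theorem column_iff (hA : Aligned A X Y) (a : ℤ) {b b' : ℤ} (h : b ≤ b')
    (hY : ∀ y ∈ Y, y ≤ b ∨ b' < y) : (a, b) ∈ A ↔ (a, b') ∈ A :=
  hA.swap.row_iff a h hY

end Aligned

theorem exists_pred {Y : Finset ℤ} {b : ℤ} (h : ∃ y ∈ Y, y ≤ b) :
    ∃ y ∈ Y, y ≤ b ∧ ∀ z ∈ Y, z ≤ y ∨ b < z := by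
  obtain ⟨y, hy, hb⟩ := h
  obtain ⟨x, hx, hmax⟩ := (Y.filter (· ≤ b)).exists_max_image id ⟨y, by simp [hy, hb]⟩
  simp only [Finset.mem_filter, id] at hx hmax
  exact ⟨x, hx.1, hx.2, fun z hz => (le_or_gt z b).imp_left fun h => hmax z ⟨hz, h⟩⟩

theorem exists_succ {Y : Finset ℤ} {b : ℤ} (h : ∃ y ∈ Y, b < y) :
    ∃ y ∈ Y, b < y ∧ ∀ z ∈ Y, z ≤ b ∨ y ≤ z := by
  obtain ⟨y, hy, hb⟩ := h
  obtain ⟨x, hx, hmin⟩ := (Y.filter (b < ·)).exists_min_image id ⟨y, by simp [hy, hb]⟩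
  simp only [Finset.mem_filter, id] at hx hmin
  exact ⟨x, hx.1, hx.2, fun z hz => (le_or_gt z b).imp_right fun h => hmin z ⟨hz, h⟩⟩

/-- `A` is a set of unit squares in `[0, m]²` which is a union of blocks of the grid given by `X`
and `Y`. -/
structure IsBlockSet (m : ℤ) (A : Set (ℤ × ℤ)) (X Y : Finset ℤ) : Prop where
  aligned : Aligned A X Y
  bound : ∀ c ∈ A, (0 ≤ c.1 ∧ c.1 < m) ∧ 0 ≤ c.2 ∧ c.2 < m
  zero_x : 0 ∈ X
  last_x : m ∈ X
  zero_y : 0 ∈ Y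
  last_y : m ∈ Y

namespace IsBlockSet

variable {m : ℤ} {A : Set (ℤ × ℤ)} {X Y : Finset ℤ}

theorem finite (h : IsBlockSet m A X Y) : A.Finite :=
  ((Set.finite_Ico 0 m).prod (Set.finite_Ico 0 m)).subset h.bound

theorem swap (h : IsBlockSet m A X Y) : IsBlockSet m (Prod.swap ⁻¹' A) Y X :=
  ⟨h.aligned.swap, fun _ hc => (h.bound _ hc).symm, h.zero_y, h.last_y, h.zero_x, h.last_x⟩

/-- The vertical edges of the boundary. -/
theorem exists_vertical_edges (h : IsBlockSet m A X Y) :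
    ∃ E : Finset ((ℤ × ℤ) × (ℤ × ℤ)), E.card ≤ X.card * Y.card ∧
      (∀ e ∈ E, e.1.1 = e.2.1 ∧ e.1.2 ≤ e.2.2) ∧
      ∀ p : ℝ × ℝ, (∃ a a' b, (a, b) ∈ A ∧ (a', b) ∉ A ∧ p ∈ unitSquare (a, b) ∧
        p ∈ unitSquare (a', b)) ↔ ∃ e ∈ E, p.1 = e.1.1 ∧ (e.1.2 : ℝ) ≤ p.2 ∧ p.2 ≤ e.2.2 := by
  classical
  -- `s b` is the next row of `Y` above `b`. For `b ≥ m` its value is arbitrary and never used.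
  have hs : ∀ b : ℤ, ∃ y, b < m → y ∈ Y ∧ b < y ∧ ∀ z ∈ Y, z ≤ b ∨ y ≤ z := fun b => by
    by_cases hb : b < m
    · obtain ⟨y, hy⟩ := exists_succ ⟨m, h.last_y, hb⟩
      exact ⟨y, fun _ => hy⟩
    · exact ⟨0, fun h => absurd h hb⟩
  choose s hs using hs
  -- An edge starts at each grid node whose left and right squares differ in membership, and runs up
  -- to the next row of `Y`; by alignment the two memberships stay constant along it.
  refine ⟨((X ×ˢ Y).filter fun c => c.2 < m ∧ ¬((c.1 - 1, c.2) ∈ A ↔ c ∈ A)).image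
    fun c => (c, (c.1, s c.2)), ?_, ?_, ?_⟩
  · exact Finset.card_image_le.trans ((Finset.card_filter_le _ _).trans
      (Finset.card_product _ _).le)
  · intro e he
    simp only [Finset.mem_image, Finset.mem_filter] at he
    obtain ⟨c, ⟨-, hc, -⟩, rfl⟩ := he
    exact ⟨rfl, (hs _ hc).2.1.le⟩
  · intro p
    constructor
    · rintro ⟨a, a', b, hA, hA', hp, hp'⟩
      obtain ⟨x, hx, hxA⟩ : ∃ x : ℤ, p.1 = x ∧ ¬((x - 1, b) ∈ A ↔ (x, b) ∈ A) := by
        obtain ⟨⟨k1, k2⟩, -⟩ := mem_unitSquare.1 hp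
        obtain ⟨⟨k3, k4⟩, -⟩ := mem_unitSquare.1 hp'
        have l1 := k1.trans k4
        have l2 := k3.trans k2
        simp only at l1 l2 k1 k2 k3 k4
        norm_cast at l1 l2
        have hne : a ≠ a' := fun e => hA' (e ▸ hA)
        rcases hne.lt_or_gt with hlt | hlt
        · obtain rfl : a' = a + 1 := by omega
          refine ⟨a + 1, ?_, by simp [hA, hA']⟩
          push_cast at k3 ⊢
          exact le_antisymm k2 k3
        · obtain rfl : a = a' + 1 := by omega
          refine ⟨a' + 1, ?_, by simp [hA, hA']⟩
          push_cast at k1 ⊢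
          exact le_antisymm k4 k1
      have hb : 0 ≤ b ∧ b < m := (h.bound _ hA).2
      have hxX : x ∈ X := by_contra fun hn => hxA (h.aligned.left x b hn)
      obtain ⟨y, hy, hyb, hyY⟩ := exists_pred ⟨0, h.zero_y, hb.1⟩
      obtain ⟨-, hsy, hsY⟩ := hs y (hyb.trans_lt hb.2)
      have hbs : b + 1 ≤ s y := by
        rcases hyY _ (hs y (hyb.trans_lt hb.2)).1 with h | h <;> omega
      refine ⟨((x, y), (x, s y)), ?_, hx, ?_, ?_⟩
      · simp only [Finset.mem_image, Finset.mem_filter, Finset.mem_product]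
        refine ⟨(x, y), ⟨⟨hxX, hy⟩, hyb.trans_lt hb.2, ?_⟩, rfl⟩
        rwa [h.aligned.column_iff (x - 1) hyb hyY, h.aligned.column_iff x hyb hyY]
      · exact le_trans (by exact_mod_cast hyb) (mem_unitSquare.1 hp).2.1
      · exact (mem_unitSquare.1 hp).2.2.trans (by exact_mod_cast hbs)
    · rintro ⟨e, he, h1, h2, h3⟩
      simp only [Finset.mem_image, Finset.mem_filter, Finset.mem_product] at he
      obtain ⟨⟨x, y⟩, ⟨⟨hxX, hyY⟩, hym, hxy⟩, rfl⟩ := he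
      obtain ⟨-, hsy, hsY⟩ := hs y hym
      simp only at h1 h2 h3
      -- At the upper end point the floor would give the row above the edge, so the row `s y - 1` is
      -- taken there.
      obtain ⟨b, hb1, hb2, hb3, hb4⟩ : ∃ b : ℤ, y ≤ b ∧ b < s y ∧ (b : ℝ) ≤ p.2 ∧ p.2 ≤ b + 1 := by
        rcases h3.lt_or_eq with hlt | heq
        · exact ⟨⌊p.2⌋, Int.le_floor.2 h2, Int.floor_lt.2 hlt, Int.floor_le _,
            (Int.lt_floor_add_one _).le⟩
        · exact ⟨s y - 1, by omega, by omega, by rw [heq]; push_cast; linarith,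
            by rw [heq]; push_cast; linarith⟩
      have hY : ∀ z ∈ Y, z ≤ y ∨ b < z := fun z hz => (hsY z hz).imp_right fun h => by omega
      simp only at hxy
      rw [h.aligned.column_iff (x - 1) hb1 hY, h.aligned.column_iff x hb1 hY] at hxy
      have m1 : p ∈ unitSquare (x - 1, b) := by
        refine ⟨⟨?_, ?_⟩, hb3, hb4⟩ <;> · simp only [h1]; push_cast; linarith
      have m2 : p ∈ unitSquare (x, b) := by
        refine ⟨⟨?_, ?_⟩, hb3, hb4⟩ <;> · simp only [h1]; linarith
      by_cases hA : (x, b) ∈ A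
      · exact ⟨x, x - 1, b, hA, by tauto, m2, m1⟩
      · exact ⟨x - 1, x, b, by tauto, hA, m1, m2⟩

end IsBlockSet

/-! ### Block sets as polygonal regions with integral corners. -/

theorem mem_segment_vertical {x y y' : ℝ} (h : y ≤ y') {p : ℝ × ℝ} :
    p ∈ segment ℝ (x, y) (x, y') ↔ p.1 = x ∧ y ≤ p.2 ∧ p.2 ≤ y' := by
  rw [← Prod.image_mk_segment_right, segment_eq_Icc h]
  constructor
  · rintro ⟨t, ht, rfl⟩
    exact ⟨rfl, ht⟩
  · rintro ⟨h1, h2⟩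
    exact ⟨p.2, h2, by rw [← h1]⟩

theorem mem_segment_horizontal {x x' y : ℝ} (h : x ≤ x') {p : ℝ × ℝ} :
    p ∈ segment ℝ (x, y) (x', y) ↔ p.2 = y ∧ x ≤ p.1 ∧ p.1 ≤ x' := by
  rw [← Prod.image_mk_segment_left, segment_eq_Icc h]
  constructor
  · rintro ⟨t, ht, rfl⟩
    exact ⟨rfl, ht⟩
  · rintro ⟨h1, h2⟩
    exact ⟨p.1, h2, by rw [← h1]⟩

/-- If `p` lies in a square `(a, b)` of `A` and a square `(a', b')` outside, it also lies in `(a',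
b)`. Membership changes on one of the two axis-parallel steps, so vertical and horizontal edges
together cover the boundary, isolated corner contacts included. -/
theorem mem_frontier_gridUnion {A : Set (ℤ × ℤ)} {p : ℝ × ℝ} :
    p ∈ frontier (gridUnion A) ↔
      (∃ a a' b, (a, b) ∈ A ∧ (a', b) ∉ A ∧ p ∈ unitSquare (a, b) ∧ p ∈ unitSquare (a', b)) ∨
      ∃ a b b', (a, b) ∈ A ∧ (a, b') ∉ A ∧ p ∈ unitSquare (a, b) ∧ p ∈ unitSquare (a, b') := by
  rw [frontier_gridUnion]
  constructor
  · rintro ⟨hA, hA'⟩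
    obtain ⟨⟨a, b⟩, hc, hpc⟩ := mem_gridUnion.1 hA
    obtain ⟨⟨a', b'⟩, hd, hpd⟩ := mem_gridUnion.1 hA'
    by_cases h : (a', b) ∈ A
    · exact .inr ⟨a', b, b', h, hd, ⟨hpd.1, hpc.2⟩, hpd⟩
    · exact .inl ⟨a, a', b, hc, h, hpc, hpd.1, hpc.2⟩
  · rintro (⟨a, a', b, h1, h2, h3, h4⟩ | ⟨a, b, b', h1, h2, h3, h4⟩) <;>
    exact ⟨mem_gridUnion.2 ⟨_, h1, h3⟩, mem_gridUnion.2 ⟨_, h2, h4⟩⟩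

/-- The real point with given integral coordinates. -/
def realPoint (c : ℤ × ℤ) : ℝ × ℝ := (c.1, c.2)

theorem IsBlockSet.exists_isRegion {m : ℤ} {A : Set (ℤ × ℤ)} {X Y : Finset ℤ}
    (h : IsBlockSet m A X Y) :
    ∃ E : Finset ((ℝ × ℝ) × (ℝ × ℝ)), E.card ≤ 2 * (X.card * Y.card) ∧
      IsRegion (gridUnion A) E ∧ ∀ e ∈ E, IsIntegral e.1 ∧ IsIntegral e.2 := by
  classical
  obtain ⟨V, hV, hVe, hVp⟩ := h.exists_vertical_edges
  obtain ⟨H, hH, hHe, hHp⟩ := h.swap.exists_vertical_edges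
  refine ⟨V.image (fun e => (realPoint e.1, realPoint e.2)) ∪
    H.image (fun e => (realPoint e.1.swap, realPoint e.2.swap)), ?_, ⟨?_, ?_, ?_, ?_⟩, ?_⟩
  · refine (Finset.card_union_le _ _).trans ?_
    have h1 := (Finset.card_image_le (s := V) (f := fun e => (realPoint e.1, realPoint e.2)))
    have h2 := (Finset.card_image_le (s := H)
      (f := fun e => (realPoint e.1.swap, realPoint e.2.swap)))
    rw [mul_comm Y.card] at hH
    omega
  · exact isCompact_gridUnion h.finite
  · exact closure_interior_gridUnion A
  · intro e he
    simp only [Finset.mem_union, Finset.mem_image] at he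
    obtain ⟨e, he, rfl⟩ | ⟨e, he, rfl⟩ := he
    · left
      simp [realPoint, (hVe e he).1]
    · right
      simp [realPoint, (hHe e he).1]
  · ext p
    rw [mem_frontier_gridUnion, hVp p]
    have h2 := hHp p.swap
    simp only [Set.mem_iUnion, Finset.mem_union, Finset.mem_image, exists_prop]
    have h3 : (∃ a b b', (a, b) ∈ A ∧ (a, b') ∉ A ∧ p ∈ unitSquare (a, b) ∧
        p ∈ unitSquare (a, b')) ↔ ∃ b b' a, (b, a) ∈ Prod.swap ⁻¹' A ∧ (b', a) ∉ Prod.swap ⁻¹' A ∧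
          p.swap ∈ unitSquare (b, a) ∧ p.swap ∈ unitSquare (b', a) := by
      have hsw : ∀ a b : ℤ, p.swap ∈ unitSquare (b, a) ↔ p ∈ unitSquare (a, b) :=
        fun a b => and_comm
      simp only [hsw]
      constructor
      · rintro ⟨a, b, b', h⟩
        exact ⟨b, b', a, h⟩
      · rintro ⟨b, b', a, h⟩
        exact ⟨a, b, b', h⟩
    rw [h3, h2]
    constructor
    · rintro (⟨e, he, hp⟩ | ⟨e, he, hp⟩)
      · refine ⟨_, .inl ⟨e, he, rfl⟩, ?_⟩
        simp only [realPoint, ← (hVe e he).1]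
        rwa [mem_segment_vertical (by exact_mod_cast (hVe e he).2)]
      · refine ⟨_, .inr ⟨e, he, rfl⟩, ?_⟩
        simp only [realPoint, Prod.fst_swap, Prod.snd_swap, ← (hHe e he).1]
        rwa [mem_segment_horizontal (by exact_mod_cast (hHe e he).2)]
    · rintro ⟨_, ⟨e, he, rfl⟩ | ⟨e, he, rfl⟩, hp⟩
      · refine .inl ⟨e, he, ?_⟩
        simp only [realPoint, ← (hVe e he).1] at hp
        rwa [mem_segment_vertical (by exact_mod_cast (hVe e he).2)] at hp
      · refine .inr ⟨e, he, ?_⟩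
        simp only [realPoint, Prod.fst_swap, Prod.snd_swap, ← (hHe e he).1] at hp
        rwa [mem_segment_horizontal (by exact_mod_cast (hHe e he).2)] at hp
  · intro e he
    simp only [Finset.mem_union, Finset.mem_image] at he
    obtain ⟨e, he, rfl⟩ | ⟨e, he, rfl⟩ := he
    · exact ⟨⟨_, _, rfl⟩, _, _, rfl⟩
    · exact ⟨⟨_, _, rfl⟩, _, _, rfl⟩

/-! ### Connected components of block sets. -/

theorem mem_connectedComponentIn_of_isPreconnected {α : Type*} [TopologicalSpace α] {F s : Set α}
    {x p q : α} (hs : IsPreconnected s) (hsF : s ⊆ F) (hp : p ∈ s) (hq : q ∈ s)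
    (h : p ∈ connectedComponentIn F x) : q ∈ connectedComponentIn F x := by
  rw [connectedComponentIn_eq h]
  exact hs.subset_connectedComponentIn hp hsF hq

/-- The unit squares of the connected component of the square `c` in the union of those in `B`. -/
def component (B : Set (ℤ × ℤ)) (c : ℤ × ℤ) : Set (ℤ × ℤ) :=
  {d | center d ∈ connectedComponentIn (gridUnion B) (center c)}

theorem component_subset {B : Set (ℤ × ℤ)} (c : ℤ × ℤ) : component B c ⊆ B := fun _ hd =>
  center_mem_gridUnion.1 (connectedComponentIn_subset _ _ hd)

theorem mem_component_self {B : Set (ℤ × ℤ)} {c : ℤ × ℤ} (h : c ∈ B) : c ∈ component B c :=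
  mem_connectedComponentIn (center_mem_gridUnion.2 h)

theorem component_eq {B : Set (ℤ × ℤ)} {c d : ℤ × ℤ} (h : d ∈ component B c) :
    component B c = component B d := by
  simp only [component, connectedComponentIn_eq h]

theorem mem_component_of_common_point {B : Set (ℤ × ℤ)} {c d d' : ℤ × ℤ} {p : ℝ × ℝ}
    (hd : d ∈ component B c) (hd' : d' ∈ B) (hp : p ∈ unitSquare d) (hp' : p ∈ unitSquare d') :
    d' ∈ component B c :=
  mem_connectedComponentIn_of_isPreconnected (isPreconnected_unitSquare d')
    (unitSquare_subset_gridUnion hd') hp' (center_mem_unitSquare d')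
    (mem_connectedComponentIn_of_isPreconnected (isPreconnected_unitSquare d)
      (unitSquare_subset_gridUnion (component_subset c hd)) (center_mem_unitSquare d) hp hd)

/-- A unit square is connected, so a topological component contains all of it as soon as it contains
one of its points. -/
theorem gridUnion_component {B : Set (ℤ × ℤ)} (c : ℤ × ℤ) :
    gridUnion (component B c) = connectedComponentIn (gridUnion B) (center c) := by
  ext p
  constructor
  · intro hp
    obtain ⟨d, hd, hpd⟩ := mem_gridUnion.1 hp
    exact mem_connectedComponentIn_of_isPreconnected (isPreconnected_unitSquare d)
      (unitSquare_subset_gridUnion (component_subset c hd)) (center_mem_unitSquare d) hpd hd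
  · intro hp
    obtain ⟨d, hd, hpd⟩ := mem_gridUnion.1 (connectedComponentIn_subset _ _ hp)
    exact mem_gridUnion.2 ⟨d, mem_connectedComponentIn_of_isPreconnected
      (isPreconnected_unitSquare d) (unitSquare_subset_gridUnion hd) hpd
      (center_mem_unitSquare d) hp, hpd⟩

/-- Neighbouring squares of `B` share a corner and so lie in the same component; splitting into
components needs no new grid lines. -/
theorem Aligned.component {B : Set (ℤ × ℤ)} {X Y : Finset ℤ} (h : Aligned B X Y) (c : ℤ × ℤ) :
    Aligned (component B c) X Y := by
  constructor
  · intro a b ha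
    have h1 : ((a : ℝ), (b : ℝ)) ∈ unitSquare (a - 1, b) := by simp [mem_unitSquare]
    have h2 : ((a : ℝ), (b : ℝ)) ∈ unitSquare (a, b) := by simp [mem_unitSquare]
    exact ⟨fun hd => mem_component_of_common_point hd
        ((h.left a b ha).1 (component_subset c hd)) h1 h2,
      fun hd => mem_component_of_common_point hd
        ((h.left a b ha).2 (component_subset c hd)) h2 h1⟩
  · intro a b hb
    have h1 : ((a : ℝ), (b : ℝ)) ∈ unitSquare (a, b - 1) := by simp [mem_unitSquare]
    have h2 : ((a : ℝ), (b : ℝ)) ∈ unitSquare (a, b) := by simp [mem_unitSquare]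
    exact ⟨fun hd => mem_component_of_common_point hd
        ((h.down a b hb).1 (component_subset c hd)) h1 h2,
      fun hd => mem_component_of_common_point hd
        ((h.down a b hb).2 (component_subset c hd)) h2 h1⟩

theorem IsBlockSet.subset {m : ℤ} {A B : Set (ℤ × ℤ)} {X Y X' Y' : Finset ℤ}
    (h : IsBlockSet m A X Y) (hX : X ⊆ X') (hY : Y ⊆ Y') (hB : Aligned B X' Y') (hBA : B ⊆ A) :
    IsBlockSet m B X' Y' :=
  ⟨hB, fun c hc => h.bound c (hBA hc), hX h.zero_x, hX h.last_x, hY h.zero_y, hY h.last_y⟩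

/-- Every component contains the lower left square of some block, and those squares are indexed by
`X ×ˢ Y`; this bounds the number of components. The last clause ensures that no rectangle is split
between components. -/
theorem IsBlockSet.exists_components {m : ℤ} {B : Set (ℤ × ℤ)} {X Y : Finset ℤ}
    (h : IsBlockSet m B X Y) :
    ∃ Q : Finset (Set (ℤ × ℤ)), Q.card ≤ X.card * Y.card ∧
      (∀ C ∈ Q, C ⊆ B ∧ IsBlockSet m C X Y ∧ IsConnected (gridUnion C)) ∧
      (∀ C ∈ Q, ∀ D ∈ Q, C ≠ D → Disjoint C D) ∧ (∀ c ∈ B, ∃ C ∈ Q, c ∈ C) ∧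
      ∀ s, IsPreconnected s → s.Nonempty → s ⊆ gridUnion B → ∃ C ∈ Q, s ⊆ gridUnion C := by
  classical
  have key : ∀ c ∈ B, ∃ d ∈ X ×ˢ Y, d ∈ B ∧ GeoDP.component B d = GeoDP.component B c := by
    intro c hc
    obtain ⟨⟨h1, -⟩, h2, -⟩ := h.bound c hc
    obtain ⟨x, hx, hxc, hxX⟩ := exists_pred ⟨0, h.zero_x, h1⟩
    obtain ⟨y, hy, hyc, hyY⟩ := exists_pred ⟨0, h.zero_y, h2⟩
    have hd : (x, y) ∈ GeoDP.component B c := by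
      rw [(h.aligned.component c).row_iff y hxc hxX, (h.aligned.component c).column_iff _ hyc hyY]
      exact mem_component_self hc
    exact ⟨(x, y), Finset.mk_mem_product hx hy, component_subset c hd, (component_eq hd).symm⟩
  have mem : ∀ c ∈ B, GeoDP.component B c ∈
      ((X ×ˢ Y).filter (· ∈ B)).image (GeoDP.component B) := by
    intro c hc
    obtain ⟨d, hd, hdB, hdc⟩ := key c hc
    exact Finset.mem_image.2 ⟨d, Finset.mem_filter.2 ⟨hd, hdB⟩, hdc⟩
  refine ⟨((X ×ˢ Y).filter (· ∈ B)).image (GeoDP.component B), ?_, ?_, ?_, ?_, ?_⟩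
  · exact Finset.card_image_le.trans ((Finset.card_filter_le _ _).trans
      (Finset.card_product _ _).le)
  · intro C hC
    obtain ⟨c, hc, rfl⟩ := Finset.mem_image.1 hC
    refine ⟨component_subset c, h.subset subset_rfl subset_rfl (h.aligned.component c)
      (component_subset c), ?_⟩
    rw [gridUnion_component, isConnected_connectedComponentIn_iff]
    exact center_mem_gridUnion.2 (Finset.mem_filter.1 hc).2
  · intro C hC D hD hne
    obtain ⟨c, hc, rfl⟩ := Finset.mem_image.1 hC
    obtain ⟨d, hd, rfl⟩ := Finset.mem_image.1 hD
    exact Set.disjoint_left.2 fun e h1 h2 => hne ((component_eq h1).trans (component_eq h2).symm)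
  · exact fun c hc => ⟨_, mem c hc, mem_component_self hc⟩
  · intro s hs hne hsB
    obtain ⟨p, hp⟩ := hne
    obtain ⟨c, hc, hpc⟩ := mem_gridUnion.1 (hsB hp)
    refine ⟨_, mem c hc, ?_⟩
    have hpC := unitSquare_subset_gridUnion (mem_component_self hc) hpc
    rw [gridUnion_component] at hpC ⊢
    rw [connectedComponentIn_eq hpC]
    exact hs.subset_connectedComponentIn hp hsB

/-! ### Cells are unions of unit squares -/

/-- The unit squares with centre in `P`. -/
def gridOf (P : Set (ℝ × ℝ)) : Set (ℤ × ℤ) := {c | center c ∈ P}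

/-- The lower left corners of the unit squares in the input square. -/
def inputGrid (n : ℕ) : Set (ℤ × ℤ) := Set.Ico 0 (2 * (n : ℤ) - 1) ×ˢ Set.Ico 0 (2 * (n : ℤ) - 1)

theorem finite_inputGrid (n : ℕ) : (inputGrid n).Finite :=
  (Set.finite_Ico _ _).prod (Set.finite_Ico _ _)

theorem subset_interior_or_compl {P s : Set (ℝ × ℝ)} (hs : IsPreconnected s)
    (h : Disjoint s (frontier P)) : s ⊆ interior P ∨ s ⊆ Pᶜ := by
  by_contra hcon
  push Not at hcon
  obtain ⟨hc1, hc2⟩ := hcon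
  obtain ⟨p, hp, hpP⟩ := Set.not_subset.1 hc1
  obtain ⟨q, hq, hqP⟩ := Set.not_subset.1 hc2
  rw [Set.notMem_compl_iff] at hqP
  have hcover : s ⊆ interior P ∪ (closure P)ᶜ := fun r hr => by
    by_contra hn
    simp only [Set.mem_union, Set.mem_compl_iff, not_or, not_not] at hn
    exact Set.disjoint_left.1 h hr ⟨hn.2, hn.1⟩
  have hdisj : s ∩ (interior P ∩ (closure P)ᶜ) = ∅ := by
    ext r
    simp only [Set.mem_inter_iff, Set.mem_compl_iff, Set.mem_empty_iff_false, iff_false]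
    exact fun hr => hr.2.2 (interior_subset_closure hr.2.1)
  rcases isPreconnected_iff_subset_of_disjoint.1 hs (interior P) (closure P)ᶜ
    isOpen_interior isClosed_closure.isOpen_compl hcover hdisj with h1 | h1
  · exact hpP (h1 hp)
  · exact h1 hq (subset_closure hqP)

theorem disjoint_openUnitSquare_segment {a b : ℝ × ℝ} (ha : IsIntegral a) (hb : IsIntegral b)
    (hab : a.1 = b.1 ∨ a.2 = b.2) (c : ℤ × ℤ) :
    Disjoint (openUnitSquare c) (segment ℝ a b) := by
  rw [Set.disjoint_left]
  rintro p hp hs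
  obtain ⟨x, y, rfl⟩ := ha
  obtain ⟨x', y', rfl⟩ := hb
  obtain ⟨⟨h1, h2⟩, h3, h4⟩ := mem_openUnitSquare.1 hp
  obtain ⟨s, t, hs, ht, hst, rfl⟩ := hs
  simp only [Prod.smul_mk, Prod.mk_add_mk, smul_eq_mul] at h1 h2 h3 h4 hab
  rcases hab with hab | hab
  · rw [← hab, ← add_mul, hst, one_mul] at h1 h2
    norm_cast at h1 h2
    omega
  · rw [← hab, ← add_mul, hst, one_mul] at h3 h4
    norm_cast at h3 h4
    omega

namespace IsCell

variable {n k : ℕ} {P : Set (ℝ × ℝ)}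

theorem openUnitSquare_subset (h : IsCell n k P) (c : ℤ × ℤ) :
    openUnitSquare c ⊆ interior P ∨ openUnitSquare c ⊆ Pᶜ := by
  refine subset_interior_or_compl (isPreconnected_openUnitSquare c) ?_
  obtain ⟨E, -, hE, hint⟩ := h.edges
  rw [hE.frontier_eq, Set.disjoint_iUnion₂_right]
  exact fun e he => disjoint_openUnitSquare_segment (hint e he).1 (hint e he).2
    (hE.axisParallel e he) c

/-- Integral boundary segments miss every open unit square, so each one is entirely inside or
outside `P`; regularity of `P` then recovers it from the squares inside. In particular there are
only finitely many cells. -/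
theorem gridUnion_gridOf (h : IsCell n k P) : gridUnion (gridOf P) = P := by
  obtain ⟨E, -, hE, -⟩ := h.edges
  apply Set.Subset.antisymm
  · refine Set.iUnion₂_subset fun c hc => ?_
    have hsub : openUnitSquare c ⊆ interior P :=
      (h.openUnitSquare_subset c).resolve_right fun hn => hn (center_mem c) hc
    rw [← closure_openUnitSquare, ← hE.regular]
    exact closure_mono hsub
  · nth_rw 1 [← hE.regular]
    refine closure_minimal (fun p hp => ?_) (isClosed_gridUnion _)
    have hpc := mem_unitSquare_floor p
    refine mem_gridUnion.2 ⟨_, ?_, hpc⟩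
    rw [← closure_openUnitSquare] at hpc
    obtain ⟨q, hq, hqc⟩ := mem_closure_iff.1 hpc _ isOpen_interior hp
    have hsub := (h.openUnitSquare_subset _).resolve_right fun hn => hn hqc (interior_subset hq)
    exact interior_subset (s := P) (hsub (center_mem (⌊p.1⌋, ⌊p.2⌋)))

theorem gridOf_subset (h : IsCell n k P) : gridOf P ⊆ inputGrid n := by
  intro c hc
  obtain ⟨⟨h1, h2⟩, h3, h4⟩ := h.subset hc
  simp only [center] at h1 h2 h3 h4
  have a1 : (0 : ℝ) < c.1 + 1 := by linarith
  have a2 : (c.1 : ℝ) < 2 * n - 1 := by linarith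
  have a3 : (0 : ℝ) < c.2 + 1 := by linarith
  have a4 : (c.2 : ℝ) < 2 * n - 1 := by linarith
  have e : (2 * n - 1 : ℝ) = ((2 * n - 1 : ℤ) : ℝ) := by push_cast; rfl
  rw [e] at a2 a4
  norm_cast at a1 a2 a3 a4
  exact ⟨⟨by lia, a2⟩, by lia, a4⟩

/-- The number of unit squares is the measure for recursion over the table. -/
theorem ncard_gridOf_lt (hP : IsCell n k P) {A : Set (ℝ × ℝ)} (hA : IsCell n k A) (hAP : A ⊆ P)
    (hne : A ≠ P) : (gridOf A).ncard < (gridOf P).ncard := by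
  refine Set.ncard_lt_ncard (Set.ssubset_iff_subset_ne.2 ⟨fun c hc => hAP hc, fun he => hne ?_⟩)
    ((finite_inputGrid n).subset hP.gridOf_subset)
  rw [← hA.gridUnion_gridOf, he, hP.gridUnion_gridOf]

end IsCell

theorem finite_cells (n k : ℕ) : {P | IsCell n k P}.Finite :=
  ((finite_inputGrid n).finite_subsets.image gridUnion).subset fun P hP =>
    ⟨gridOf P, IsCell.gridOf_subset hP, IsCell.gridUnion_gridOf hP⟩

theorem finite_partitions (n k : ℕ) (P : Set (ℝ × ℝ)) : {Q | IsPartition n k P Q}.Finite := by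
  classical
  refine (finite_cells n k).toFinset.powerset.finite_toSet.subset fun Q hQ => ?_
  simp only [Finset.coe_powerset, Set.mem_preimage, Set.mem_powerset_iff]
  intro A hA
  simpa using hQ.cells A hA

theorem IsPartition.subset {n k : ℕ} {P : Set (ℝ × ℝ)} {Q : Finset (Set (ℝ × ℝ))}
    (h : IsPartition n k P Q) {A : Set (ℝ × ℝ)} (hA : A ∈ Q) : A ⊆ P :=
  h.union_eq ▸ Set.subset_biUnion_of_mem (u := fun A => A) hA

theorem IsPartition.ne {n k : ℕ} {P : Set (ℝ × ℝ)} {Q : Finset (Set (ℝ × ℝ))}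
    (h : IsPartition n k P Q) {A : Set (ℝ × ℝ)} (hA : A ∈ Q) : A ≠ P :=
  fun e => h.proper (e ▸ hA)

/-! ### Rectangles -/

theorem Rect.isOpen_area (R : Rect) : IsOpen R.area := isOpen_Ioo.prod isOpen_Ioo

theorem Rect.isPreconnected_area (R : Rect) : IsPreconnected R.area :=
  isPreconnected_Ioo.prod isPreconnected_Ioo

theorem Rect.nonempty_area (R : Rect) : R.area.Nonempty :=
  (Set.nonempty_Ioo.2 (by exact_mod_cast R.hx)).prod
    (Set.nonempty_Ioo.2 (by exact_mod_cast R.hy))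

/-- The unit squares in a rectangle. -/
def Rect.squares (R : Rect) : Set (ℤ × ℤ) :=
  Set.Ico (R.x₁ : ℤ) R.x₂ ×ˢ Set.Ico (R.y₁ : ℤ) R.y₂

theorem Rect.openUnitSquare_subset_area {R : Rect} {c : ℤ × ℤ} (h : c ∈ R.squares) :
    openUnitSquare c ⊆ R.area := by
  obtain ⟨⟨h1, h2⟩, h3, h4⟩ := h
  rintro p ⟨⟨k1, k2⟩, k3, k4⟩
  have g1 : (R.x₁ : ℝ) ≤ c.1 := by exact_mod_cast h1
  have g2 : (c.1 + 1 : ℝ) ≤ R.x₂ := by exact_mod_cast h2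
  have g3 : (R.y₁ : ℝ) ≤ c.2 := by exact_mod_cast h3
  have g4 : (c.2 + 1 : ℝ) ≤ R.y₂ := by exact_mod_cast h4
  exact ⟨⟨g1.trans_lt k1, k2.trans_le g2⟩, g3.trans_lt k3, k4.trans_le g4⟩

theorem Rect.floor_mem_squares {R : Rect} {p : ℝ × ℝ} (h : p ∈ R.area) :
    (⌊p.1⌋, ⌊p.2⌋) ∈ R.squares := by
  obtain ⟨⟨h1, h2⟩, h3, h4⟩ := h
  exact ⟨⟨Int.le_floor.2 (by exact_mod_cast h1.le), Int.floor_lt.2 (by exact_mod_cast h2)⟩,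
    Int.le_floor.2 (by exact_mod_cast h3.le), Int.floor_lt.2 (by exact_mod_cast h4)⟩

theorem Rect.area_subset_gridUnion {R : Rect} {A : Set (ℤ × ℤ)} :
    R.area ⊆ gridUnion A ↔ R.squares ⊆ A :=
  ⟨fun h c hc => mem_of_mem_gridUnion (center_mem c)
      (h (Rect.openUnitSquare_subset_area hc (center_mem c))),
    fun h p hp => mem_gridUnion.2 ⟨_, h (Rect.floor_mem_squares hp), mem_unitSquare_floor p⟩⟩

theorem Rect.nonempty_squares (R : Rect) : R.squares.Nonempty :=
  R.nonempty_area.imp' _ fun _ => Rect.floor_mem_squares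

theorem Rect.disjoint_area_iff {R R' : Rect} :
    Disjoint R.area R'.area ↔ Disjoint R.squares R'.squares := by
  simp only [Set.disjoint_left]
  exact ⟨fun h c hc hc' => h (Rect.openUnitSquare_subset_area hc (center_mem c))
      (Rect.openUnitSquare_subset_area hc' (center_mem c)),
    fun h p hp hp' => h (Rect.floor_mem_squares hp) (Rect.floor_mem_squares hp')⟩

theorem Rect.disjoint_area_of_disjoint_interior {R R' : Rect} {A B : Set (ℝ × ℝ)} (hR : R.area ⊆ A)
    (hR' : R'.area ⊆ B) (h : Disjoint (interior A) (interior B)) : Disjoint R.area R'.area :=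
  h.mono (interior_maximal hR R.isOpen_area) (interior_maximal hR' R'.isOpen_area)

theorem Rect.ne_of_disjoint_interior {R R' : Rect} {A B : Set (ℝ × ℝ)} (hR : R.area ⊆ A)
    (hR' : R'.area ⊆ B) (h : Disjoint (interior A) (interior B)) : R ≠ R' := by
  rintro rfl
  have := Rect.disjoint_area_of_disjoint_interior hR hR' h
  rw [disjoint_self] at this
  exact R.nonempty_area.ne_empty this

/-! ### Tables of the dynamic program -/

section Table

variable {n k : ℕ} {R : Fin n → Rect} {w : Fin n → ℝ} {sol : Set (ℝ × ℝ) → Finset (Fin n)}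

theorem mem_rectsIn {P : Set (ℝ × ℝ)} {i : Fin n} : i ∈ rectsIn R P ↔ (R i).area ⊆ P := by
  simp [rectsIn]

theorem weight_nonneg (hw : ∀ i, 0 ≤ w i) (S : Finset (Fin n)) : 0 ≤ weight w S :=
  Finset.sum_nonneg fun i _ => hw i

theorem weight_mono (hw : ∀ i, 0 ≤ w i) {S T : Finset (Fin n)} (h : S ⊆ T) :
    weight w S ≤ weight w T :=
  Finset.sum_le_sum_of_subset_of_nonneg h fun i _ _ => hw i

/-- `s` is a possible entry for `P`, given the entries `sol` for smaller cells. -/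
def IsEntry (k : ℕ) (R : Fin n → Rect) (w : Fin n → ℝ) (sol : Set (ℝ × ℝ) → Finset (Fin n))
    (P : Set (ℝ × ℝ)) (s : Finset (Fin n)) : Prop :=
  (rectsIn R P = ∅ ∧ s = ∅) ∨
  ((rectsIn R P).Nonempty ∧ ∃ Q, IsPartition n k P Q ∧
    (∀ Q', IsPartition n k P Q' → profit w sol Q' ≤ profit w sol Q) ∧
    (∀ i ∈ rectsIn R P, w i < profit w sol Q) ∧ ∀ i, i ∈ s ↔ ∃ A ∈ Q, i ∈ sol A) ∨
  (∃ i ∈ rectsIn R P, (∀ j ∈ rectsIn R P, w j ≤ w i) ∧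
    (∀ Q, IsPartition n k P Q → profit w sol Q ≤ w i) ∧ s = {i})

theorem isTable_iff : IsTable k R w sol ↔ ∀ P, IsCell n k P → IsEntry k R w sol P (sol P) := by
  simp only [IsTable, IsEntry, Finset.ext_iff, Finset.mem_biUnion]

theorem exists_isEntry (sol : Set (ℝ × ℝ) → Finset (Fin n)) (P : Set (ℝ × ℝ)) :
    ∃ s, IsEntry k R w sol P s := by
  classical
  rcases (rectsIn R P).eq_empty_or_nonempty with hP | hP
  · exact ⟨∅, .inl ⟨hP, rfl⟩⟩
  obtain ⟨i, hi, hmax⟩ := (rectsIn R P).exists_max_image w hP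
  by_cases h : ∃ Q, IsPartition n k P Q ∧ w i < profit w sol Q
  · obtain ⟨Q₀, hQ₀, hlt⟩ := h
    obtain ⟨Q, hQ, hQmax⟩ := Set.exists_max_image _ (profit w sol) (finite_partitions n k P)
      ⟨Q₀, hQ₀⟩
    exact ⟨Q.biUnion sol, .inr (.inl ⟨hP, Q, hQ, hQmax, fun j hj =>
      (hmax j hj).trans_lt (hlt.trans_le (hQmax _ hQ₀)), by simp⟩)⟩
  · push Not at h
    exact ⟨{i}, .inr (.inr ⟨i, hi, hmax, h, rfl⟩)⟩

theorem profit_congr {sol' : Set (ℝ × ℝ) → Finset (Fin n)} {Q : Finset (Set (ℝ × ℝ))}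
    (h : ∀ A ∈ Q, sol A = sol' A) : profit w sol Q = profit w sol' Q :=
  Finset.sum_congr rfl fun A hA => by rw [h A hA]

theorem IsEntry.congr {sol' : Set (ℝ × ℝ) → Finset (Fin n)} {P : Set (ℝ × ℝ)}
    {s : Finset (Fin n)} (hs : IsEntry k R w sol P s)
    (h : ∀ Q, IsPartition n k P Q → ∀ A ∈ Q, sol A = sol' A) : IsEntry k R w sol' P s := by
  rcases hs with hs | ⟨hP, Q, hQ, h1, h2, h3⟩ | ⟨i, hi, h1, h2, h3⟩
  · exact .inl hs
  · refine .inr (.inl ⟨hP, Q, hQ, fun Q' hQ' => ?_, fun i hi => ?_, fun i => ?_⟩)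
    · rw [← profit_congr (h Q hQ), ← profit_congr (h Q' hQ')]
      exact h1 Q' hQ'
    · rw [← profit_congr (h Q hQ)]
      exact h2 i hi
    · rw [h3 i]
      exact exists_congr fun A => and_congr_right fun hA => by rw [h Q hQ A hA]
  · exact .inr (.inr ⟨i, hi, h1, fun Q hQ => profit_congr (h Q hQ) ▸ h2 Q hQ, h3⟩)

theorem exists_isTable (k : ℕ) (R : Fin n → Rect) (w : Fin n → ℝ) : ∃ sol, IsTable k R w sol := by
  classical
  -- Cells are filled in by increasing number of squares. An entry depends only on strictly smaller
  -- cells, so later choices leave earlier entries valid.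
  have key : ∀ m : ℕ, ∃ sol : Set (ℝ × ℝ) → Finset (Fin n),
      ∀ P, IsCell n k P → (gridOf P).ncard < m → IsEntry k R w sol P (sol P) := by
    intro m
    induction m with
    | zero => exact ⟨fun _ => ∅, fun P _ h => absurd h (Nat.not_lt_zero _)⟩
    | succ m ih =>
      obtain ⟨sol, hsol⟩ := ih
      choose e he using fun P => exists_isEntry (k := k) (R := R) (w := w) sol P
      refine ⟨fun P => if (gridOf P).ncard < m then sol P else e P, fun P hP hm => ?_⟩
      have hcongr : ∀ Q, IsPartition n k P Q → ∀ A ∈ Q, sol A =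
          if (gridOf A).ncard < m then sol A else e A := by
        intro Q hQ A hA
        have := hP.ncard_gridOf_lt (hQ.cells A hA) (hQ.subset hA) (hQ.ne hA)
        rw [if_pos (by omega)]
      refine IsEntry.congr (sol := sol) ?_ hcongr
      dsimp only
      split_ifs with h
      · exact hsol P hP h
      · exact he P
  obtain ⟨sol, hsol⟩ := key ((inputGrid n).ncard + 1)
  exact ⟨sol, isTable_iff.2 fun P hP => hsol P hP
    (Nat.lt_succ_of_le (Set.ncard_le_ncard hP.gridOf_subset (finite_inputGrid n)))⟩

theorem IsCell.induction {p : Set (ℝ × ℝ) → Prop}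
    (h : ∀ P, IsCell n k P → (∀ Q, IsPartition n k P Q → ∀ A ∈ Q, p A) → p P)
    {P : Set (ℝ × ℝ)} (hP : IsCell n k P) : p P := by
  induction hm : (gridOf P).ncard using Nat.strong_induction_on generalizing P with
  | _ m ih =>
    subst hm
    exact h P hP fun Q hQ A hA => ih _
      (hP.ncard_gridOf_lt (hQ.cells A hA) (hQ.subset hA) (hQ.ne hA)) (hQ.cells A hA) rfl

namespace IsTable

theorem sol_subset (h : IsTable k R w sol) {P : Set (ℝ × ℝ)} (hP : IsCell n k P) :
    ∀ i ∈ sol P, (R i).area ⊆ P := by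
  refine hP.induction (p := fun P => ∀ i ∈ sol P, (R i).area ⊆ P) fun P hP ih i hi => ?_
  rcases isTable_iff.1 h P hP with ⟨-, hs⟩ | ⟨-, Q, hQ, -, -, hs⟩ | ⟨j, hj, -, -, hs⟩
  · simp [hs] at hi
  · obtain ⟨A, hA, hiA⟩ := (hs i).1 hi
    exact (ih Q hQ A hA i hiA).trans (hQ.subset hA)
  · rw [hs, Finset.mem_singleton] at hi
    exact hi ▸ mem_rectsIn.1 hj

theorem isIndependent (h : IsTable k R w sol) {P : Set (ℝ × ℝ)} (hP : IsCell n k P) :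
    IsIndependent R (sol P) := by
  refine hP.induction (p := fun P => IsIndependent R (sol P)) fun P hP ih i hi j hj hij => ?_
  rcases isTable_iff.1 h P hP with ⟨-, hs⟩ | ⟨-, Q, hQ, -, -, hs⟩ | ⟨l, hl, -, -, hs⟩
  · simp [hs] at hi
  · obtain ⟨A, hA, hiA⟩ := (hs i).1 hi
    obtain ⟨B, hB, hjB⟩ := (hs j).1 hj
    rcases eq_or_ne A B with rfl | hAB
    · exact ih Q hQ A hA i hiA j hjB hij
    · exact Rect.disjoint_area_of_disjoint_interior (h.sol_subset (hQ.cells A hA) i hiA)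
        (h.sol_subset (hQ.cells B hB) j hjB) (hQ.disjoint A hA B hB hAB)
  · rw [hs, Finset.mem_singleton] at hi hj
    exact absurd (hi.trans hj.symm) hij

/-- Entries of different parts share no index, because their interiors are disjoint and areas are
nonempty and open. So the weight of the chosen union equals its profit, which is maximal. -/
theorem profit_le (h : IsTable k R w sol) {P : Set (ℝ × ℝ)} (hP : IsCell n k P)
    {Q : Finset (Set (ℝ × ℝ))} (hQ : IsPartition n k P Q) (hne : (rectsIn R P).Nonempty) :
    profit w sol Q ≤ weight w (sol P) := by
  classical
  rcases isTable_iff.1 h P hP with ⟨h0, -⟩ | ⟨-, Q', hQ', hmax, -, hs⟩ | ⟨l, hl, -, hmax, hs⟩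
  · exact absurd h0 hne.ne_empty
  · refine (hmax Q hQ).trans ?_
    have e : sol P = Q'.biUnion sol := by
      ext i
      rw [hs, Finset.mem_biUnion]
    rw [e, weight, Finset.sum_biUnion]
    · rfl
    · intro A hA B hB hAB
      refine Finset.disjoint_left.2 fun i hiA hiB => ?_
      exact Rect.ne_of_disjoint_interior (h.sol_subset (hQ'.cells A hA) i hiA)
        (h.sol_subset (hQ'.cells B hB) i hiB) (hQ'.disjoint A hA B hB hAB) rfl
  · rw [hs]
    simpa [weight] using hmax Q hQ

theorem le_weight (h : IsTable k R w sol) {P : Set (ℝ × ℝ)} (hP : IsCell n k P) {i : Fin n}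
    (hi : (R i).area ⊆ P) : w i ≤ weight w (sol P) := by
  have hi' := mem_rectsIn.2 hi
  have hne : (rectsIn R P).Nonempty := ⟨i, hi'⟩
  rcases id (isTable_iff.1 h P hP) with ⟨h0, -⟩ | ⟨-, Q', hQ', -, hlt, -⟩ | ⟨l, hl, hmax, -, hs⟩
  · exact absurd h0 hne.ne_empty
  · exact (hlt i hi').le.trans (h.profit_le hP hQ' hne)
  · rw [hs]
    simpa [weight] using hmax i hi'

end IsTable

end Table

/-! ### Cuts along lines of the integer grid -/

theorem mem_iff_of_disjoint_frontier {P s : Set (ℝ × ℝ)} (hs : IsPreconnected s)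
    (h : Disjoint s (frontier P)) {p q : ℝ × ℝ} (hp : p ∈ s) (hq : q ∈ s) : p ∈ P ↔ q ∈ P := by
  rcases subset_interior_or_compl hs h with h | h
  · exact iff_of_true (interior_subset (h hp)) (interior_subset (h hq))
  · exact iff_of_false (h hp) (h hq)

/-- The unit squares `c` for which `P` contains the point `c + (δ, δ)`. -/
def sample (P : Set (ℝ × ℝ)) (δ : ℝ) : Set (ℤ × ℤ) := {c | ((c.1 + δ, c.2 + δ) : ℝ × ℝ) ∈ P}

/-- A line at `x` between the sample columns `a - 1 + δ` and `a + δ` becomes the integral line `a`.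
The condition on `Int.fract x` excludes `x = a + δ`, where the floor would jump. -/
theorem floor_sub_add_one_eq {a : ℤ} {δ x : ℝ} (hδ : δ ∈ Set.Ioo (0 : ℝ) 1)
    (hx : Int.fract x ≠ δ) (h1 : ((a - 1 : ℤ) : ℝ) + δ ≤ x) (h2 : x ≤ a + δ) :
    ⌊x - δ⌋ + 1 = a := by
  have hne : x ≠ a + δ := by
    rintro rfl
    rw [Int.fract_intCast_add, Int.fract_eq_self.2 ⟨hδ.1.le, hδ.2⟩] at hx
    exact hx rfl
  have hlt := lt_of_le_of_ne h2 hne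
  have : ⌊x - δ⌋ = a - 1 := by
    rw [Int.floor_eq_iff]
    push_cast at h1 ⊢
    constructor <;> linarith
  omega

/-- The segment joining two neighbouring sample points of a row has height `b + δ`, which is on no
line of `W`. Membership in `P` can therefore change along it only at a line of `V`; likewise for
columns. -/
theorem aligned_sample {P : Set (ℝ × ℝ)} {V W : Finset ℝ} {δ : ℝ} (hδ : δ ∈ Set.Ioo (0 : ℝ) 1)
    (hV : ∀ x ∈ V, Int.fract x ≠ δ) (hW : ∀ y ∈ W, Int.fract y ≠ δ)
    (hP : ∀ p ∈ frontier P, p.1 ∈ V ∨ p.2 ∈ W) :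
    Aligned (sample P δ) (V.image fun x => ⌊x - δ⌋ + 1) (W.image fun y => ⌊y - δ⌋ + 1) := by
  have hfr : ∀ b : ℤ, Int.fract (b + δ) = δ := fun b => by
    rw [Int.fract_intCast_add, Int.fract_eq_self.2 ⟨hδ.1.le, hδ.2⟩]
  constructor
  · intro a b ha
    have hle : ((a - 1 : ℤ) : ℝ) + δ ≤ a + δ := by push_cast; linarith
    refine mem_iff_of_disjoint_frontier
      (s := Set.Icc (((a - 1 : ℤ) : ℝ) + δ) (a + δ) ×ˢ {(b : ℝ) + δ})
      (isPreconnected_Icc.prod isPreconnected_singleton) ?_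
      ⟨Set.left_mem_Icc.2 hle, rfl⟩ ⟨Set.right_mem_Icc.2 hle, rfl⟩
    rw [Set.disjoint_left]
    rintro p ⟨⟨h1, h2⟩, h3⟩ hp
    rcases hP p hp with h | h
    · exact ha (Finset.mem_image.2 ⟨_, h, floor_sub_add_one_eq hδ (hV _ h) h1 h2⟩)
    · exact hW _ h ((congrArg Int.fract h3).trans (hfr b))
  · intro a b hb
    have hle : ((b - 1 : ℤ) : ℝ) + δ ≤ b + δ := by push_cast; linarith
    refine mem_iff_of_disjoint_frontier
      (s := {(a : ℝ) + δ} ×ˢ Set.Icc (((b - 1 : ℤ) : ℝ) + δ) (b + δ))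
      (isPreconnected_singleton.prod isPreconnected_Icc) ?_
      ⟨rfl, Set.left_mem_Icc.2 hle⟩ ⟨rfl, Set.right_mem_Icc.2 hle⟩
    rw [Set.disjoint_left]
    rintro p ⟨h3, h1, h2⟩ hp
    rcases hP p hp with h | h
    · exact hV _ h ((congrArg Int.fract h3).trans (hfr a))
    · exact hb (Finset.mem_image.2 ⟨_, h, floor_sub_add_one_eq hδ (hW _ h) h1 h2⟩)

theorem IsRegion.mem_frontier {P : Set (ℝ × ℝ)} {E : Finset ((ℝ × ℝ) × (ℝ × ℝ))}
    (h : IsRegion P E) {p : ℝ × ℝ} (hp : p ∈ frontier P) :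
    p.1 ∈ E.image (fun e => e.1.1) ∨ p.2 ∈ E.image (fun e => e.1.2) := by
  rw [h.frontier_eq] at hp
  simp only [Set.mem_iUnion] at hp
  obtain ⟨e, he, s, t, hs, ht, hst, rfl⟩ := hp
  refine (h.axisParallel e he).imp (fun h => ?_) fun h => ?_ <;>
  · refine Finset.mem_image.2 ⟨e, he, ?_⟩
    simp [← h, ← add_mul, hst]

theorem Rect.sample_mem_area {R : Rect} {c : ℤ × ℤ} (hc : c ∈ R.squares) {δ : ℝ}
    (hδ : δ ∈ Set.Ioo (0 : ℝ) 1) : ((c.1 + δ, c.2 + δ) : ℝ × ℝ) ∈ R.area := by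
  refine Rect.openUnitSquare_subset_area hc ?_
  obtain ⟨h1, h2⟩ := hδ
  simp only [mem_openUnitSquare]
  refine ⟨⟨?_, ?_⟩, ?_, ?_⟩ <;> linarith

/-- Only finitely many `δ` are forbidden. A rectangle has integral corners, so it contains the
sample points of all its unit squares and stays on its side of the cut. -/
theorem IsRegion.exists_sample {P : Set (ℝ × ℝ)} {E : Finset ((ℝ × ℝ) × (ℝ × ℝ))}
    (h : IsRegion P E) :
    ∃ (S : Set (ℤ × ℤ)) (X Y : Finset ℤ), X.card ≤ E.card ∧ Y.card ≤ E.card ∧ Aligned S X Y ∧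
      (∀ R : Rect, R.area ⊆ P → R.squares ⊆ S) ∧ ∀ R : Rect, R.area ⊆ Pᶜ → R.squares ⊆ Sᶜ := by
  classical
  obtain ⟨δ, hδ, hn⟩ := (Set.Ioo_infinite (zero_lt_one (α := ℝ))).exists_notMem_finset
    ((E.image (fun e => e.1.1) ∪ E.image (fun e => e.1.2)).image Int.fract)
  simp only [Finset.mem_image, Finset.mem_union, not_exists, not_and] at hn
  exact ⟨sample P δ, _, _, Finset.card_image_le.trans Finset.card_image_le,
    Finset.card_image_le.trans Finset.card_image_le,
    aligned_sample hδ (fun x hx => hn x (.inl (Finset.mem_image.1 hx)))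
      (fun y hy => hn y (.inr (Finset.mem_image.1 hy))) fun p hp => h.mem_frontier hp,
    fun R hR c hc => hR (Rect.sample_mem_area hc hδ),
    fun R hR c hc => hR (Rect.sample_mem_area hc hδ)⟩

theorem Rect.aligned_squares (R : Rect) :
    Aligned R.squares {(R.x₁ : ℤ), (R.x₂ : ℤ)} {(R.y₁ : ℤ), (R.y₂ : ℤ)} := by
  constructor
  · intro a b ha
    simp only [Finset.mem_insert, Finset.mem_singleton, not_or] at ha
    simp only [Rect.squares, Set.mem_prod, Set.mem_Ico]
    omega
  · intro a b ha
    simp only [Finset.mem_insert, Finset.mem_singleton, not_or] at ha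
    simp only [Rect.squares, Set.mem_prod, Set.mem_Ico]
    omega

section

variable {n : ℕ} {R : Fin n → Rect} {w : Fin n → ℝ}

theorem weight_union_le (hw : ∀ i, 0 ≤ w i) (S T : Finset (Fin n)) :
    weight w (S ∪ T) ≤ weight w S + weight w T := by
  have h := Finset.sum_union_inter (s₁ := S) (s₂ := T) (f := w)
  have h' := weight_nonneg hw (S ∩ T)
  simp only [weight] at *
  linarith

open Classical in
theorem weight_equivFin (T : Finset (Fin n)) (p : Fin n → Prop) :
    weight (fun j => w (T.equivFin.symm j)) {j | p (T.equivFin.symm j)} =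
      weight w (T.filter p) := by
  rw [weight, weight, Finset.sum_filter, Finset.sum_filter,
    T.equivFin.symm.sum_comp fun i => if p i then w i else 0,
    Finset.sum_coe_sort T fun i => if p i then w i else 0]

/-- The rectangles of `T` are separated into the parts inside and outside a set `S` of unit
squares, at the loss of a small part of the weight. -/
theorem GoodCuts.exists_sample {α : ℝ} {ℓ : ℕ} (h : GoodCuts α ℓ) (hα : 0 ≤ α) (hℓ : 2 ≤ ℓ)
    (hw : ∀ i, 0 < w i) {T : Finset (Fin n)} (hT : IsIndependent R T) :
    ∃ (S : Set (ℤ × ℤ)) (X Y : Finset ℤ) (T₁ T₂ : Finset (Fin n)),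
      X.card ≤ ℓ ∧ Y.card ≤ ℓ ∧ Aligned S X Y ∧ T₁ ⊆ T ∧ T₂ ⊆ T ∧
      (∀ i ∈ T₁, (R i).squares ⊆ S) ∧ (∀ i ∈ T₂, (R i).squares ⊆ Sᶜ) ∧
      (1 - α) * weight w T ≤ weight w T₁ + weight w T₂ ∧
      (weight w T₁ ≤ 2 / 3 * weight w T ∨ T₁.card ≤ 1) ∧ weight w T₂ ≤ 2 / 3 * weight w T := by
  classical
  have hw' : ∀ i, 0 ≤ w i := fun i => (hw i).le
  have hsum : weight (fun j => w (T.equivFin.symm j)) Finset.univ = weight w T := by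
    simpa using weight_equivFin (w := w) T fun _ => True
  rcases h T.card (fun j => R (T.equivFin.symm j)) (fun j => w (T.equivFin.symm j))
    (fun j => hw _) (fun i _ j _ hij => hT _ (T.equivFin.symm i).2 _ (T.equivFin.symm j).2
      fun e => hij (T.equivFin.symm.injective (Subtype.ext e))) with ⟨P, hP⟩ | ⟨j, hj⟩
  · obtain ⟨E, hE, hreg⟩ := hP.edges
    obtain ⟨S, X, Y, hX, hY, hS, hin, hout⟩ := hreg.exists_sample
    have h0 := hP.cheap
    have h1 := hP.inside
    have h2 := hP.outside
    rw [hsum] at h0 h1 h2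
    rw [weight_equivFin T fun i => ((R i).area ∩ frontier P).Nonempty] at h0
    rw [weight_equivFin T fun i => (R i).area ⊆ P] at h1
    rw [weight_equivFin T fun i => (R i).area ⊆ Pᶜ] at h2
    refine ⟨S, X, Y, T.filter fun i => (R i).area ⊆ P, T.filter fun i => (R i).area ⊆ Pᶜ,
      hX.trans hE, hY.trans hE, hS, Finset.filter_subset _ _, Finset.filter_subset _ _,
      fun i hi => hin _ (Finset.mem_filter.1 hi).2, fun i hi => hout _ (Finset.mem_filter.1 hi).2,
      ?_, .inl h1, h2⟩
    have hsub : T ⊆ (T.filter fun i => ((R i).area ∩ frontier P).Nonempty) ∪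
        ((T.filter fun i => (R i).area ⊆ P) ∪ T.filter fun i => (R i).area ⊆ Pᶜ) := by
      intro i hi
      simp only [Finset.mem_union, Finset.mem_filter, hi, true_and]
      by_cases hd : Disjoint (R i).area (frontier P)
      · exact .inr ((subset_interior_or_compl (R i).isPreconnected_area hd).imp_left
          fun h => h.trans interior_subset)
      · exact .inl (Set.not_disjoint_iff_nonempty_inter.1 hd)
    have h3 := (weight_mono hw' hsub).trans ((weight_union_le hw' _ _).trans
      (add_le_add_right (weight_union_le hw' _ _) _))
    linarith
  · rw [hsum] at hj
    generalize T.equivFin.symm j = x at hj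
    obtain ⟨i, hi⟩ := x
    have herase : weight w (T.erase i) + w i = weight w T := Finset.sum_erase_add _ _ hi
    have hT0 := weight_nonneg hw' T
    have hone : weight w {i} = w i := Finset.sum_singleton _ _
    -- The heavy rectangle is cut out along its own outline, which uses two lines in each direction.
    -- It may exceed two thirds of the weight, hence the alternative `T₁.card ≤ 1`.
    refine ⟨(R i).squares, _, _, {i}, T.erase i, Finset.card_le_two.trans hℓ,
      Finset.card_le_two.trans hℓ, (R i).aligned_squares, Finset.singleton_subset_iff.2 hi,
      Finset.erase_subset _ _, ?_, ?_, ?_, .inr (Finset.card_singleton i).le, ?_⟩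
    · simp
    · intro l hl
      obtain ⟨hne, hlT⟩ := Finset.mem_erase.1 hl
      exact Set.subset_compl_iff_disjoint_right.2
        (Rect.disjoint_area_iff.1 (hT l hlT i hi hne))
    · rw [hone]
      nlinarith
    · linarith

end

/-! ### The recursive partition -/

section

variable {n k : ℕ} {R : Fin n → Rect} {w : Fin n → ℝ} {sol : Set (ℝ × ℝ) → Finset (Fin n)}

theorem IsBlockSet.isCell {A : Set (ℤ × ℤ)} {X Y : Finset ℤ}
    (h : IsBlockSet (2 * n - 1) A X Y) (hA : IsConnected (gridUnion A))
    (hk : 2 * (X.card * Y.card) ≤ k) : IsCell n k (gridUnion A) := by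
  refine ⟨fun p hp => ?_, hA, ?_⟩
  · obtain ⟨c, hc, ⟨h1, h2⟩, h3, h4⟩ := mem_gridUnion.1 hp
    obtain ⟨⟨k1, k2⟩, k3, k4⟩ := h.bound c hc
    have g1 : (0 : ℝ) ≤ c.1 := by exact_mod_cast k1
    have g2 : (c.1 + 1 : ℝ) ≤ 2 * n - 1 := by
      have : ((c.1 + 1 : ℤ) : ℝ) ≤ ((2 * n - 1 : ℤ) : ℝ) := Int.cast_le.2 (by omega)
      simpa using this
    have g3 : (0 : ℝ) ≤ c.2 := by exact_mod_cast k3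
    have g4 : (c.2 + 1 : ℝ) ≤ 2 * n - 1 := by
      have : ((c.2 + 1 : ℤ) : ℝ) ≤ ((2 * n - 1 : ℤ) : ℝ) := Int.cast_le.2 (by omega)
      simpa using this
    exact ⟨⟨g1.trans h1, h2.trans g2⟩, g3.trans h3, h4.trans g4⟩
  · obtain ⟨E, hE, hE'⟩ := h.exists_isRegion
    exact ⟨E, hE.trans hk, hE'⟩

theorem gridUnion_biUnion (Q : Finset (Set (ℤ × ℤ))) :
    gridUnion (⋃ C ∈ Q, C) = ⋃ C ∈ Q, gridUnion C := by
  ext p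
  simp only [mem_gridUnion, Set.mem_iUnion]
  constructor
  · rintro ⟨c, ⟨C, hC, hc⟩, hp⟩
    exact ⟨C, hC, c, hc, hp⟩
  · rintro ⟨C, hC, c, hc, hp⟩
    exact ⟨c, ⟨C, hC, hc⟩, hp⟩

/-- A partition of `A` into cells gives a lower bound on the entry of `A`, also if it is
trivial. -/
theorem IsTable.sum_le (h : IsTable k R w sol) {A : Set (ℤ × ℤ)} (hA : IsCell n k (gridUnion A))
    {Q : Finset (Set (ℤ × ℤ))} (hcard : Q.card ≤ k) (hcells : ∀ C ∈ Q, IsCell n k (gridUnion C))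
    (hdisj : ∀ C ∈ Q, ∀ D ∈ Q, C ≠ D → Disjoint C D) (hunion : ⋃ C ∈ Q, C = A)
    (hne : (rectsIn R (gridUnion A)).Nonempty) :
    ∑ C ∈ Q, weight w (sol (gridUnion C)) ≤ weight w (sol (gridUnion A)) := by
  classical
  by_cases hAQ : A ∈ Q
  · have hQ : Q = {A} := by
      refine Finset.eq_singleton_iff_unique_mem.2 ⟨hAQ, fun C hC => ?_⟩
      by_contra hCA
      obtain ⟨p, hp⟩ := (hcells C hC).connected.nonempty
      obtain ⟨c, hc, -⟩ := mem_gridUnion.1 hp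
      refine Set.disjoint_left.1 (hdisj C hC A hAQ hCA) hc ?_
      rw [← hunion]
      exact Set.mem_biUnion hC hc
    rw [hQ, Finset.sum_singleton]
  · have hpart : IsPartition n k (gridUnion A) (Q.image gridUnion) := by
      refine ⟨Finset.card_image_le.trans hcard, ?_, ?_, ?_, ?_⟩
      · intro P hP
        obtain ⟨C, hC, rfl⟩ := Finset.mem_image.1 hP
        exact hcells C hC
      · intro P hP P' hP' hPP'
        obtain ⟨C, hC, rfl⟩ := Finset.mem_image.1 hP
        obtain ⟨D, hD, rfl⟩ := Finset.mem_image.1 hP'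
        exact disjoint_interior_gridUnion (hdisj C hC D hD fun e => hPP' (e ▸ rfl))
      · rw [← hunion, gridUnion_biUnion, Finset.set_biUnion_finset_image]
      · intro hP
        obtain ⟨C, hC, he⟩ := Finset.mem_image.1 hP
        exact hAQ (gridUnion_injective he ▸ hC)
    have := h.profit_le hA hpart hne
    rwa [profit, Finset.sum_image gridUnion_injective.injOn] at this

theorem weight_le_sum_squares (hw : ∀ i, 0 ≤ w i) {Q : Finset (Set (ℤ × ℤ))}
    {T : Finset (Fin n)} {t : Set (ℤ × ℤ) → Finset (Fin n)}
    (h : ∀ i ∈ T, ∃ C ∈ Q, i ∈ t C) : weight w T ≤ ∑ C ∈ Q, weight w (t C) := by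
  classical
  have key : ∀ Q : Finset (Set (ℤ × ℤ)), weight w (Q.biUnion t) ≤ ∑ C ∈ Q, weight w (t C) := by
    intro Q
    induction Q using Finset.induction_on with
    | empty => simp [weight]
    | insert C Q hC ih =>
      rw [Finset.biUnion_insert, Finset.sum_insert hC]
      exact (weight_union_le hw _ _).trans (add_le_add_right ih _)
  exact (weight_mono hw fun i hi => Finset.mem_biUnion.2 (h i hi)).trans (key Q)

/-- Induction on the number `d` of levels still available. The hypotheses on `X` and `Y` reserve `ℓ`
further lines in each direction per level, and the weight bound `(3 / 2) ^ d` ensures that `d`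
balanced cuts isolate single rectangles. -/
theorem IsTable.lower_bound (h : IsTable k R w sol) {α : ℝ} {ℓ : ℕ} (hgood : GoodCuts α ℓ)
    (hα : 0 ≤ α) (hα' : α ≤ 1) (hℓ : 2 ≤ ℓ) (hw : ∀ i, 1 ≤ w i) {M : ℕ} (hM : 2 * (M * M) ≤ k)
    (d : ℕ) : ∀ (A : Set (ℤ × ℤ)) (X Y : Finset ℤ), IsBlockSet (2 * n - 1) A X Y →
      IsConnected (gridUnion A) → X.card + d * ℓ ≤ M → Y.card + d * ℓ ≤ M →
      ∀ T : Finset (Fin n), IsIndependent R T → (∀ i ∈ T, (R i).squares ⊆ A) →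
        (weight w T ≤ (3 / 2) ^ d ∨ T.card ≤ 1) →
        (1 - α) ^ d * weight w T ≤ weight w (sol (gridUnion A)) := by
  classical
  have hw0 : ∀ i, 0 < w i := fun i => zero_lt_one.trans_le (hw i)
  have hw' : ∀ i, 0 ≤ w i := fun i => (hw0 i).le
  have cell : ∀ (A : Set (ℤ × ℤ)) (X Y : Finset ℤ), IsBlockSet (2 * n - 1) A X Y →
      IsConnected (gridUnion A) → X.card ≤ M → Y.card ≤ M → IsCell n k (gridUnion A) :=
    fun A X Y hA hAc hX hY => hA.isCell hAc
      ((Nat.mul_le_mul_left 2 (Nat.mul_le_mul hX hY)).trans hM)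
  have single : ∀ d : ℕ, ∀ A, IsCell n k (gridUnion A) → ∀ T : Finset (Fin n),
      (∀ i ∈ T, (R i).squares ⊆ A) → T.card ≤ 1 →
        (1 - α) ^ d * weight w T ≤ weight w (sol (gridUnion A)) := by
    intro d A hA T hT hcard
    refine (mul_le_of_le_one_left (weight_nonneg hw' T)
      (pow_le_one₀ (by linarith) (by linarith))).trans ?_
    rcases T.eq_empty_or_nonempty with rfl | ⟨i, hi⟩
    · exact weight_nonneg hw' _
    · have hTi : T = {i} := Finset.eq_singleton_iff_unique_mem.2
        ⟨hi, fun j hj => Finset.card_le_one.1 hcard j hj i hi⟩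
      rw [hTi, weight, Finset.sum_singleton]
      exact h.le_weight hA (Rect.area_subset_gridUnion.2 (hT i hi))
  induction d with
  | zero =>
    intro A X Y hA hAc hX hY T hT hTA hwT
    -- Total weight at most 1 with all weights at least 1 leaves at most one rectangle.
    refine single 0 A (cell A X Y hA hAc (by omega) (by omega)) T hTA (hwT.elim (fun h1 => ?_) id)
    have : (T.card : ℝ) ≤ weight w T := by
      simpa [weight] using Finset.card_nsmul_le_sum T w 1 fun i _ => hw i
    exact_mod_cast this.trans (h1.trans_eq (pow_zero _))
  | succ d ih =>
    intro A X Y hA hAc hX hY T hT hTA hwT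
    have hAcell := cell A X Y hA hAc (by omega) (by omega)
    by_cases hcard : T.card ≤ 1
    · exact single _ A hAcell T hTA hcard
    replace hwT := hwT.resolve_right hcard
    obtain ⟨S, X', Y', T₁, T₂, hX', hY', hS, hT₁, hT₂, hS₁, hS₂, hsum, hw₁, hw₂⟩ :=
      hgood.exists_sample hα hℓ hw0 hT
    have hA' := hA.aligned.mono (Finset.subset_union_left (s₂ := X'))
      (Finset.subset_union_left (s₂ := Y'))
    have hS' := hS.mono (Finset.subset_union_right (s₁ := X))
      (Finset.subset_union_right (s₁ := Y))
    have hXc : (X ∪ X').card + d * ℓ ≤ M := by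
      have := Finset.card_union_le X X'
      rw [Nat.succ_mul] at hX
      omega
    have hYc : (Y ∪ Y').card + d * ℓ ≤ M := by
      have := Finset.card_union_le Y Y'
      rw [Nat.succ_mul] at hY
      omega
    have hXY : (X ∪ X').card * (Y ∪ Y').card ≤ M * M := Nat.mul_le_mul (by omega) (by omega)
    -- Cells must be connected, so `A ∩ S` and `A ∩ Sᶜ` are each split into components: at most `M *
    -- M` each, hence at most `k` together.
    obtain ⟨Q₁, hQ₁, hc₁, hd₁, hu₁, hr₁⟩ := (hA.subset Finset.subset_union_left
      Finset.subset_union_left (hA'.inter hS') Set.inter_subset_left).exists_components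
    obtain ⟨Q₂, hQ₂, hc₂, hd₂, hu₂, hr₂⟩ := (hA.subset Finset.subset_union_left
      Finset.subset_union_left (hA'.inter hS'.compl) Set.inter_subset_left).exists_components
    have hblock : ∀ C ∈ Q₁ ∪ Q₂, IsBlockSet (2 * n - 1) C (X ∪ X') (Y ∪ Y') ∧
        IsConnected (gridUnion C) := fun C hC =>
      (Finset.mem_union.1 hC).elim (fun h => (hc₁ C h).2) fun h => (hc₂ C h).2
    have hcross : ∀ C ∈ Q₁, ∀ D ∈ Q₂, Disjoint C D := fun C hC D hD =>
      Set.disjoint_left.2 fun c h1 h2 => ((hc₂ D hD).1 h2).2 ((hc₁ C hC).1 h1).2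
    have hle : ∑ C ∈ Q₁ ∪ Q₂, weight w (sol (gridUnion C)) ≤ weight w (sol (gridUnion A)) := by
      refine h.sum_le hAcell ?_ (fun C hC => cell C _ _ (hblock C hC).1 (hblock C hC).2 (by omega)
        (by omega)) ?_ ?_ ?_
      · have := Finset.card_union_le Q₁ Q₂
        omega
      · intro C hC D hD hCD
        rcases Finset.mem_union.1 hC with hC | hC <;> rcases Finset.mem_union.1 hD with hD | hD
        · exact hd₁ C hC D hD hCD
        · exact hcross C hC D hD
        · exact (hcross D hD C hC).symm
        · exact hd₂ C hC D hD hCD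
      · refine Set.Subset.antisymm (Set.iUnion₂_subset fun C hC => ?_) fun c hc => ?_
        · exact (Finset.mem_union.1 hC).elim (fun h => (hc₁ C h).1.trans Set.inter_subset_left)
            fun h => (hc₂ C h).1.trans Set.inter_subset_left
        · by_cases hcS : c ∈ S
          · obtain ⟨C, hC, hcC⟩ := hu₁ c ⟨hc, hcS⟩
            exact Set.mem_biUnion (Finset.mem_union_left _ hC) hcC
          · obtain ⟨C, hC, hcC⟩ := hu₂ c ⟨hc, hcS⟩
            exact Set.mem_biUnion (Finset.mem_union_right _ hC) hcC
      · obtain ⟨i, hi⟩ := Finset.card_pos.1 (show 0 < T.card by omega)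
        exact ⟨i, mem_rectsIn.2 (Rect.area_subset_gridUnion.2 (hTA i hi))⟩
    have hT₁₂ : Disjoint T₁ T₂ := Finset.disjoint_left.2 fun i h1 h2 => by
      obtain ⟨c, hc⟩ := (R i).nonempty_squares
      exact hS₂ i h2 hc (hS₁ i h1 hc)
    have hwu : weight w (T₁ ∪ T₂) = weight w T₁ + weight w T₂ := Finset.sum_union hT₁₂
    have hcover : weight w (T₁ ∪ T₂) ≤
        ∑ C ∈ Q₁ ∪ Q₂, weight w ((T₁ ∪ T₂).filter fun i => (R i).squares ⊆ C) := by
      refine weight_le_sum_squares hw' fun i hi => ?_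
      rcases Finset.mem_union.1 hi with h1 | h2
      · obtain ⟨C, hC, hiC⟩ := hr₁ _ (R i).isPreconnected_area (R i).nonempty_area
          (Rect.area_subset_gridUnion.2 (Set.subset_inter (hTA i (hT₁ h1)) (hS₁ i h1)))
        exact ⟨C, Finset.mem_union_left _ hC,
          Finset.mem_filter.2 ⟨hi, Rect.area_subset_gridUnion.1 hiC⟩⟩
      · obtain ⟨C, hC, hiC⟩ := hr₂ _ (R i).isPreconnected_area (R i).nonempty_area
          (Rect.area_subset_gridUnion.2 (Set.subset_inter (hTA i (hT₂ h2)) (hS₂ i h2)))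
        exact ⟨C, Finset.mem_union_right _ hC,
          Finset.mem_filter.2 ⟨hi, Rect.area_subset_gridUnion.1 hiC⟩⟩
    have hpow : 2 / 3 * weight w T ≤ (3 / 2) ^ d := by
      rw [pow_succ] at hwT
      linarith
    have hpart : ∀ C ∈ Q₁ ∪ Q₂,
        (1 - α) ^ d * weight w ((T₁ ∪ T₂).filter fun i => (R i).squares ⊆ C) ≤
          weight w (sol (gridUnion C)) := by
      intro C hC
      refine ih C _ _ (hblock C hC).1 (hblock C hC).2 hXc hYc _ (fun i hi j hj =>
        hT i (Finset.union_subset hT₁ hT₂ (Finset.mem_filter.1 hi).1)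
          j (Finset.union_subset hT₁ hT₂ (Finset.mem_filter.1 hj).1))
        (fun i hi => (Finset.mem_filter.1 hi).2) ?_
      rcases Finset.mem_union.1 hC with hC | hC
      · have hsub : ((T₁ ∪ T₂).filter fun i => (R i).squares ⊆ C) ⊆ T₁ := by
          intro i hi
          obtain ⟨hi, hiC⟩ := Finset.mem_filter.1 hi
          refine (Finset.mem_union.1 hi).resolve_right fun h2 => ?_
          obtain ⟨c, hc⟩ := (R i).nonempty_squares
          exact hS₂ i h2 hc ((hc₁ C hC).1 (hiC hc)).2
        exact hw₁.imp (fun h1 => (weight_mono hw' hsub).trans (h1.trans hpow))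
          fun h1 => (Finset.card_le_card hsub).trans h1
      · have hsub : ((T₁ ∪ T₂).filter fun i => (R i).squares ⊆ C) ⊆ T₂ := by
          intro i hi
          obtain ⟨hi, hiC⟩ := Finset.mem_filter.1 hi
          refine (Finset.mem_union.1 hi).resolve_left fun h1 => ?_
          obtain ⟨c, hc⟩ := (R i).nonempty_squares
          exact ((hc₂ C hC).1 (hiC hc)).2 (hS₁ i h1 hc)
        exact .inl ((weight_mono hw' hsub).trans (hw₂.trans hpow))
    have hα0 : 0 ≤ (1 - α) ^ d := pow_nonneg (by linarith) d
    calc (1 - α) ^ (d + 1) * weight w T = (1 - α) ^ d * ((1 - α) * weight w T) := by ring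
      _ ≤ (1 - α) ^ d * weight w (T₁ ∪ T₂) :=
        mul_le_mul_of_nonneg_left (hsum.trans_eq hwu.symm) hα0
      _ ≤ (1 - α) ^ d *
          ∑ C ∈ Q₁ ∪ Q₂, weight w ((T₁ ∪ T₂).filter fun i => (R i).squares ⊆ C) :=
        mul_le_mul_of_nonneg_left hcover hα0
      _ ≤ ∑ C ∈ Q₁ ∪ Q₂, weight w (sol (gridUnion C)) := by
        rw [Finset.mul_sum]
        exact Finset.sum_le_sum hpart
      _ ≤ _ := hle

end

/-! ### The input square and the preprocessing -/

theorem exists_unit_interval {m : ℤ} {u : ℝ} (h0 : 0 ≤ u) (hm : u ≤ m) (hpos : 0 < m) :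
    ∃ a : ℤ, 0 ≤ a ∧ a < m ∧ (a : ℝ) ≤ u ∧ u ≤ a + 1 := by
  rcases hm.lt_or_eq with hlt | rfl
  · exact ⟨⌊u⌋, Int.floor_nonneg.2 h0, Int.floor_lt.2 hlt, Int.floor_le u,
      (Int.lt_floor_add_one u).le⟩
  · exact ⟨m - 1, by omega, by omega, by push_cast; linarith, by push_cast; linarith⟩

theorem gridUnion_inputGrid {n : ℕ} (hn : 0 < n) : gridUnion (inputGrid n) = inputSquare n := by
  have hcast : (2 * (n : ℝ) - 1) = ((2 * n - 1 : ℤ) : ℝ) := by push_cast; rfl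
  rw [inputSquare, hcast]
  ext p
  rw [mem_gridUnion]
  constructor
  · rintro ⟨c, ⟨⟨k1, k2⟩, k3, k4⟩, ⟨h1, h2⟩, h3, h4⟩
    have g1 : (0 : ℝ) ≤ c.1 := by exact_mod_cast k1
    have g3 : (0 : ℝ) ≤ c.2 := by exact_mod_cast k3
    have g2 : ((c.1 + 1 : ℤ) : ℝ) ≤ ((2 * n - 1 : ℤ) : ℝ) := Int.cast_le.2 (by omega)
    have g4 : ((c.2 + 1 : ℤ) : ℝ) ≤ ((2 * n - 1 : ℤ) : ℝ) := Int.cast_le.2 (by omega)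
    rw [Int.cast_add, Int.cast_one] at g2 g4
    exact ⟨⟨g1.trans h1, h2.trans g2⟩, g3.trans h3, h4.trans g4⟩
  · rintro ⟨⟨h1, h2⟩, h3, h4⟩
    obtain ⟨a, a1, a2, a3, a4⟩ := exists_unit_interval h1 h2 (by omega)
    obtain ⟨b, b1, b2, b3, b4⟩ := exists_unit_interval h3 h4 (by omega)
    exact ⟨(a, b), ⟨⟨a1, a2⟩, b1, b2⟩, ⟨a3, a4⟩, b3, b4⟩

theorem isConnected_inputSquare {n : ℕ} (hn : 0 < n) : IsConnected (inputSquare n) := by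
  have h1 : (1 : ℝ) ≤ n := by exact_mod_cast hn
  have h : (0 : ℝ) ≤ 2 * n - 1 := by linarith
  exact (isConnected_Icc h).prod (isConnected_Icc h)

theorem isBlockSet_inputGrid (n : ℕ) :
    IsBlockSet (2 * n - 1) (inputGrid n) {0, 2 * (n : ℤ) - 1} {0, 2 * (n : ℤ) - 1} where
  aligned := by
    constructor <;>
    · intro a b h
      simp only [Finset.mem_insert, Finset.mem_singleton, not_or] at h
      simp only [inputGrid, Set.mem_prod, Set.mem_Ico]
      omega
  bound _ hc := hc
  zero_x := by simp
  last_x := by simp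
  zero_y := by simp
  last_y := by simp

theorem rank_lt_rank_iff {S : Finset ℕ} {u v : ℕ} (hu : u ∈ S) : rank S u < rank S v ↔ u < v := by
  refine ⟨fun h => ?_, rank_lt_rank hu⟩
  by_contra! hvu
  refine h.not_ge (Finset.card_le_card fun s hs => ?_)
  simp only [Finset.mem_filter] at hs ⊢
  exact ⟨hs.1, hs.2.trans_le hvu⟩

theorem rank_lt_card {S : Finset ℕ} {v : ℕ} (hv : v ∈ S) : rank S v < S.card :=
  Finset.card_lt_card (Finset.filter_ssubset.2 ⟨v, hv, lt_irrefl v⟩)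

theorem Rect.disjoint_area_iff_coords {R R' : Rect} : Disjoint R.area R'.area ↔
    ¬(R.x₁ < R'.x₂ ∧ R'.x₁ < R.x₂ ∧ R.y₁ < R'.y₂ ∧ R'.y₁ < R.y₂) := by
  rw [Rect.disjoint_area_iff, Set.disjoint_left]
  constructor
  · rintro h ⟨h1, h2, h3, h4⟩
    have := R.hx
    have := R.hy
    have := R'.hx
    have := R'.hy
    refine h (a := (max (R.x₁ : ℤ) R'.x₁, max (R.y₁ : ℤ) R'.y₁)) ?_ ?_ <;>
    · simp only [Rect.squares, Set.mem_prod, Set.mem_Ico]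
      omega
  · rintro h ⟨a, b⟩ h1 h2
    simp only [Rect.squares, Set.mem_prod, Set.mem_Ico] at h1 h2
    omega

section

variable {n : ℕ} {R : Fin n → Rect}

/-- Overlap depends only on strict comparisons between lower and upper coordinates, and ranks
preserve these. -/
theorem isIndependent_normalize {S : Finset (Fin n)} :
    IsIndependent (normalize R) S ↔ IsIndependent R S := by
  unfold normalize
  split_ifs
  · rfl
  · have hx₁ : ∀ i, (R i).x₁ ∈ xCoords R := fun i => by simp [xCoords]
    have hy₁ : ∀ i, (R i).y₁ ∈ yCoords R := fun i => by simp [yCoords]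
    simp only [IsIndependent, Rect.disjoint_area_iff_coords, compress, rank_lt_rank_iff (hx₁ _),
      rank_lt_rank_iff (hy₁ _)]

theorem normalize_squares_subset (i : Fin n) : (normalize R i).squares ⊆ inputGrid n := by
  have h : (normalize R i).x₂ < 2 * n ∧ (normalize R i).y₂ < 2 * n := by
    unfold normalize
    split_ifs with h
    · exact h i
    · have hcard : ∀ f g : Fin n → ℕ,
          (Finset.univ.image f ∪ Finset.univ.image g).card ≤ 2 * n := fun f g => by
        have h1 := Finset.card_union_le (Finset.univ.image f) (Finset.univ.image g)
        have h2 := Finset.card_image_le (s := Finset.univ) (f := f)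
        have h3 := Finset.card_image_le (s := Finset.univ) (f := g)
        simp only [Finset.card_univ, Fintype.card_fin] at h2 h3
        omega
      exact ⟨(rank_lt_card (by simp)).trans_le (hcard _ _),
        (rank_lt_card (by simp)).trans_le (hcard _ _)⟩
  rintro ⟨a, b⟩ hc
  simp only [Rect.squares, inputGrid, Set.mem_prod, Set.mem_Ico] at hc ⊢
  omega

/-- The approximation guarantee for a recursion of depth `d`. -/
theorem approximates_of_depth {w : Fin n → ℝ} {k d ℓ : ℕ} {α ρ : ℝ} (hn : 0 < n)
    (hgood : GoodCuts α ℓ) (hα : 0 < α) (hα' : α < 1 / 2) (hℓ : 2 ≤ ℓ) (hw : ∀ i, 1 ≤ w i)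
    (hd : weight w Finset.univ ≤ (3 / 2) ^ d)
    (hk : 2 * ((2 + d * ℓ) * (2 + d * ℓ)) ≤ k) (hρ : (1 + α) ^ (2 * d) ≤ ρ) :
    Approximates k R w ρ := by
  have hw' : ∀ i, 0 ≤ w i := fun i => zero_le_one.trans (hw i)
  have hconn : IsConnected (gridUnion (inputGrid n)) :=
    gridUnion_inputGrid hn ▸ isConnected_inputSquare hn
  have hcard : ({0, 2 * (n : ℤ) - 1} : Finset ℤ).card ≤ 2 := Finset.card_le_two
  have hcell : IsCell n k (inputSquare n) := by
    rw [← gridUnion_inputGrid hn]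
    refine (isBlockSet_inputGrid n).isCell hconn (le_trans ?_ hk)
    exact Nat.mul_le_mul_left 2 (Nat.mul_le_mul (by omega) (by omega))
  refine ⟨exists_isTable _ _ _, fun sol hsol =>
    ⟨isIndependent_normalize.1 (hsol.isIndependent hcell), fun S hS => ?_⟩⟩
  have hbound := hsol.lower_bound hgood hα.le (by linarith) hℓ hw hk d _ _ _
    (isBlockSet_inputGrid n) hconn (by omega) (by omega) S (isIndependent_normalize.2 hS)
    (fun i _ => normalize_squares_subset i)
    (.inl ((weight_mono hw' (Finset.subset_univ S)).trans hd))
  rw [gridUnion_inputGrid hn] at hbound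
  -- For `0 < α < 1/2`, `(1 + α) ^ 2 * (1 - α) = 1 + α * (1 - α - α ^ 2) ≥ 1`.
  have hone : 1 ≤ (1 + α) ^ (2 * d) * (1 - α) ^ d := by
    rw [pow_mul, ← mul_pow]
    refine one_le_pow₀ ?_
    nlinarith [mul_pos hα hα, mul_pos hα (mul_pos hα hα)]
  calc weight w S ≤ (1 + α) ^ (2 * d) * (1 - α) ^ d * weight w S :=
        le_mul_of_one_le_left (weight_nonneg hw' S) hone
    _ = (1 + α) ^ (2 * d) * ((1 - α) ^ d * weight w S) := by ring
    _ ≤ (1 + α) ^ (2 * d) * weight w (sol (inputSquare n)) :=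
        mul_le_mul_of_nonneg_left hbound (by positivity)
    _ ≤ ρ * weight w (sol (inputSquare n)) :=
        mul_le_mul_of_nonneg_right hρ (weight_nonneg hw' _)

end

end GeoDP

/-! ### Choice of the depth and of the constants. -/

theorem mainTheorem5 :
    ∃ C₁ C₂ : ℝ, 0 < C₁ ∧ 0 < C₂ ∧
      ∀ (ε α : ℝ) (ℓ : ℕ), 0 < ε → 0 < α → α < 1 / 2 → 4 ≤ ℓ → GeoDP.GoodCuts α ℓ →
        ∀ n k : ℕ, 2 ≤ (n : ℝ) / ε → ε ^ 2 ≤ (n : ℝ) →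
          C₁ * (ℓ : ℝ) ^ 2 * Real.log ((n : ℝ) / ε) ^ 2 ≤ (k : ℝ) →
          ∀ (R : Fin n → GeoDP.Rect) (w : Fin n → ℝ),
            (∀ i, 1 ≤ w i ∧ w i ≤ (n : ℝ) / ε) →
            GeoDP.Approximates k R w ((1 + α) ^ (C₂ * Real.log ((n : ℝ) / ε))) := by
  -- With `L = log (n / ε)` and depth `d = ⌈9 * L⌉₊ ≤ 11 * L`, the exponent is `2 * d ≤ 22 * L`.
  -- Moreover `2 + d * ℓ ≤ 12 * ℓ * L`, and `288 = 2 * 12 ^ 2`.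
  refine ⟨288, 22, by norm_num, by norm_num, ?_⟩
  intro ε α ℓ hε hα hα' hℓ hgood n k hN hεn hk R w hw
  have hn : 0 < n := by
    rcases Nat.eq_zero_or_pos n with rfl | h
    · norm_num at hN
    · exact h
  have hnN : (n : ℝ) ≤ ((n : ℝ) / ε) ^ 2 := by
    have hn' : (0 : ℝ) < n := by exact_mod_cast hn
    rw [div_pow, le_div_iff₀ (by positivity), sq (n : ℝ)]
    exact mul_le_mul_of_nonneg_left hεn hn'.le
  set N := (n : ℝ) / ε
  have hN0 : 0 < N := by linarith
  have hlog2 : 0.69 ≤ Real.log N :=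
    (by linarith [Real.log_two_gt_d9] : (0.69 : ℝ) ≤ Real.log 2).trans
      (Real.log_le_log (by norm_num) hN)
  have hlog : 1 / 3 ≤ Real.log (3 / 2) := by
    have := Real.one_sub_inv_le_log_of_pos (show (0 : ℝ) < 3 / 2 by norm_num)
    norm_num at this ⊢
    exact this
  set L := Real.log N
  have hd9 : 9 * L ≤ ⌈9 * L⌉₊ := Nat.le_ceil _
  -- Rounding up costs at most `1 ≤ 2 * L`, since `L ≥ 0.69`.
  have hd11 : (⌈9 * L⌉₊ : ℝ) ≤ 11 * L :=
    (Nat.ceil_lt_add_one (by linarith)).le.trans (by linarith)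
  refine GeoDP.approximates_of_depth (d := ⌈9 * L⌉₊) hn hgood hα hα' (by omega)
    (fun i => (hw i).1) ?_ ?_ ?_
  · calc GeoDP.weight w Finset.univ ≤ n * N := by
          simpa [GeoDP.weight] using Finset.sum_le_card_nsmul Finset.univ w N fun i _ => (hw i).2
      _ ≤ N ^ 2 * N := mul_le_mul_of_nonneg_right hnN hN0.le
      _ = N ^ 3 := by ring
      -- In logarithms: `3 * L = 9 * L * (1 / 3)`, and `log (3 / 2) ≥ 1 / 3`; this is where the 9
      -- comes from.
      _ ≤ (3 / 2) ^ ⌈9 * L⌉₊ := by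
          rw [← Real.log_le_log_iff (by positivity) (by positivity), Real.log_pow, Real.log_pow]
          push_cast
          nlinarith
  · have hℓ' : (4 : ℝ) ≤ ℓ := by exact_mod_cast hℓ
    -- The summand 2 is absorbed because `ℓ * L ≥ 4 * 0.69`.
    have hM : (2 + ⌈9 * L⌉₊ * ℓ : ℝ) ≤ 12 * (ℓ * L) := by nlinarith
    have hM2 : (2 * ((2 + ⌈9 * L⌉₊ * ℓ) * (2 + ⌈9 * L⌉₊ * ℓ)) : ℝ) ≤ k := by
      refine le_trans ?_ hk
      have := mul_le_mul hM hM (by positivity) (by positivity)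
      nlinarith
    exact_mod_cast hM2
  · rw [← Real.rpow_natCast]
    refine Real.rpow_le_rpow_of_exponent_le (by linarith) ?_
    push_cast
    linarith
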